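/- All Hilbert spaces are finite-dimensional. Let $m$ be a number of parties. For a state (density matrix) $\rho^{X_1\cdots X_mE}$ let $H$ be the von Neumann entropy $H(\rho)=-\mathrm{Tr}(\rho\log_2\rho)$ of the indicated reduced state, $H(A|E)=H(AE)-H(E)$, and $$I(X_1;\dots;X_m|E)=\sum_{i=1}^m H(X_i|E)-H(X_1\cdots X_m|E).$$ The multiparty squashed entanglement of a state $\rho^{X_1\cdots X_m}$ is $$E_{\mathrm{sq}}(\rho)=\tfrac12\inf_{E}\, I(X_1;\dots;X_m|E)_{\tilde\rho},$$ where the infimum is over all systems $E$ of arbitrary finite dimension and all states $\tilde\rho^{X_1\cdots X_mE}$ with $\mathrm{Tr}_E\,\tilde\rho=\rho$. A quantum instrument is a finite collection $(\mathcal E_k)_k$ of completely positive maps, with a common input space and a common output space, such that $\sum_k\mathcal E_k$ is trace preserving; it is unilocal if it acts on one of the systems $X_i$ only (tensored with the identity on the others; the dimension of $X_i$ may change). An LOCC instrument is a finite family $(\Lambda_k)_k$ of maps from operators on $X_1\cdots X_m$ to operators on $X_1'\cdots X_m'$ obtained from the identity by finitely many steps of the following two kinds: (a) some party, chosen depending on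 the classical record so far, performs a unilocal instrument that may also depend on the record, and its outcome is appended to the record; (b) a part of the classical record is discarded, that is, the maps whose records have the same image under a function are added up. For such a family and a state $\rho$ put $p_k=\mathrm{Tr}\,\Lambda_k(\rho)$ and $\rho_k=\Lambda_k(\rho)/p_k$ (terms with $p_k=0$ count as $0$ below). **Proposition.** $E_{\mathrm{sq}}$ is an entanglement monotone: 1. it does not increase on average under LOCC: for every LOCC instrument $(\Lambda_k)_k$ and every state $\rho^{X_1\cdots X_m}$, $$\sum_k p_k\,E_{\mathrm{sq}}(\rho_k)\le E_{\mathrm{sq}}(\rho);$$ 2. in particular, the same inequality holds for every unilocal quantum instrument $(\mathcal E_k)_k$, with $p_k=\mathrm{Tr}\,\mathcal E_k(\rho)$ and $\rho_k=\mathcal E_k(\rho)/p_k$; 3. $E_{\mathrm{sq}}$ is convex: $E_{\mathrm{sq}}(\lambda\rho+(1-\lambda)\sigma)\le\lambda E_{\mathrm{sq}}(\rho)+(1-\lambda)E_{\mathrm{sq}}(\sigma)$ for all states $\rho,\sigma$ of $X_1\cdots X_m$ and all $\lambda\in[0,1]$. -/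

import Mathlib

noncomputable section

namespace SquashedEntanglement

open scoped ComplexOrder

/-- Joint index set of `m` finite-dimensional quantum systems `X₁, …, Xₘ` of dimensions
`d 0, …, d (m - 1)`: it labels the product basis of `ℂ^{d 0} ⊗ ⋯ ⊗ ℂ^{d (m - 1)}`. -/
abbrev Sys {m : ℕ} (d : Fin m → ℕ) : Type := ∀ j : Fin m, Fin (d j)

/-- Operators on the Hilbert space with orthonormal basis labelled by `a`. -/
abbrev Op (a : Type) : Type := Matrix a a ℂ

/-- Density matrices: positive semidefinite with unit trace. -/
def IsState {a : Type} [Fintype a] (ρ : Op a) : Prop :=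
  ρ.PosSemidef ∧ ρ.trace = 1

/-! ### Entropies -/

/-- Von Neumann entropy `H(ρ) = -Tr (ρ log₂ ρ)`; the logarithm of the Hermitian matrix `ρ` is taken
with the continuous functional calculus (with `0 log 0 = 0`). -/
def entropy {a : Type} [Fintype a] [DecidableEq a] (ρ : Op a) : ℝ :=
  -(ρ * cfc (Real.logb 2) ρ).trace.re

/-- Partial trace over the first tensor factor. -/
def traceLeft {a b : Type} [Fintype a] (ρ : Op (a × b)) : Op b :=
  Matrix.of fun e f => ∑ s, ρ (s, e) (s, f)

/-- Partial trace over the second tensor factor. -/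
def traceRight {a b : Type} [Fintype b] (ρ : Op (a × b)) : Op a :=
  Matrix.of fun s t => ∑ e, ρ (s, e) (t, e)

/-- Conditional entropy `H(A|B) = H(AB) - H(B)` of an operator on `AB`. -/
def condEntropy {a b : Type} [Fintype a] [DecidableEq a] [Fintype b] [DecidableEq b]
    (ρ : Op (a × b)) : ℝ :=
  entropy ρ - entropy (traceLeft ρ)

/-- The reduced operator on `XᵢE` of an operator on `X₁⋯XₘE`: all `Xⱼ` with `j ≠ i` are traced out.
The sum runs over the joint indices `s` whose `i`-th entry is prescribed. -/
def marginal {m : ℕ} {d : Fin m → ℕ} {E : Type} (i : Fin m) (ρ : Op (Sys d × E)) :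
    Op (Fin (d i) × E) :=
  Matrix.of fun p q =>
    ∑ s : Sys d, if s i = p.1 then ρ (s, p.2) (Function.update s i q.1, q.2) else 0

/-- Conditional multiparty information
`I(X₁;⋯;Xₘ|E) = ∑ᵢ H(Xᵢ|E) - H(X₁⋯Xₘ|E)` of an operator on `X₁⋯XₘE`. -/
def condMultiInfo {m : ℕ} {d : Fin m → ℕ} {E : Type} [Fintype E] [DecidableEq E]
    (ρ : Op (Sys d × E)) : ℝ :=
  (∑ i, condEntropy (marginal i ρ)) - condEntropy ρ

/-- Multiparty squashed entanglement: half the infimum of `I(X₁;⋯;Xₘ|E)` over all extensions of `ρ`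
to a state on `X₁⋯XₘE`, where `E` is a system of arbitrary finite dimension. -/
def Esq {m : ℕ} {d : Fin m → ℕ} (ρ : Op (Sys d)) : ℝ :=
  (1 / 2) * sInf {r : ℝ | ∃ (E : Type) (_ : Fintype E) (_ : DecidableEq E) (σ : Op (Sys d × E)),
    IsState σ ∧ traceRight σ = ρ ∧ r = condMultiInfo σ}

/-! ### Local operations and classical communication -/

/-- The map `Φ ⊗ id` on operators on `a ⊗ c`. -/
def ampliation {a b : Type} (c : Type) (Φ : Op a →ₗ[ℂ] Op b) (M : Op (a × c)) : Op (b × c) :=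
  Matrix.of fun p q => Φ (Matrix.of fun x y => M (x, p.2) (y, q.2)) p.1 q.1

/-- Complete positivity: every `Φ ⊗ id_n` maps positive semidefinite operators to positive
semidefinite operators. -/
def IsCompletelyPositive {a b : Type} (Φ : Op a →ₗ[ℂ] Op b) : Prop :=
  ∀ (n : ℕ) (M : Op (a × Fin n)), M.PosSemidef → (ampliation (Fin n) Φ M).PosSemidef

/-- Quantum instrument: a finite collection of completely positive maps whose sum is trace
preserving. -/
structure IsInstrument {a b K : Type} [Fintype a] [Fintype b] [Fintype K]
    (Φ : K → (Op a →ₗ[ℂ] Op b)) : Prop where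
  completelyPositive : ∀ k, IsCompletelyPositive (Φ k)
  tracePreserving : ∀ M : Op a, (∑ k, Φ k M).trace = M.trace

/-- The joint index for the dimensions `d` whose `i`-th entry is `x` and whose other entries are
those of `a`. -/
def replaceAt {m : ℕ} {d d' : Fin m → ℕ} (i : Fin m) (h : ∀ j, j ≠ i → d' j = d j)
    (x : Fin (d i)) (a : Sys d') : Sys d :=
  fun j => if hj : j = i then Fin.cast (congrArg d hj.symm) x else Fin.cast (h j hj) (a j)

/-- The map `Φ` applied to the system `Xᵢ`, tensored with the identity on all `Xⱼ`, `j ≠ i`. The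
dimension of `Xᵢ` may change; those of the other systems are unchanged. -/
def applyAt {m : ℕ} {d d' : Fin m → ℕ} (i : Fin m) (h : ∀ j, j ≠ i → d' j = d j)
    (Φ : Op (Fin (d i)) →ₗ[ℂ] Op (Fin (d' i))) (M : Op (Sys d)) : Op (Sys d') :=
  Matrix.of fun a b =>
    Φ (Matrix.of fun x y => M (replaceAt i h x a) (replaceAt i h y b)) (a i) (b i)

/-- `Λ` is a unilocal quantum instrument, acting on party `i` only. -/
def IsUnilocalInstrument {m : ℕ} {d d' : Fin m → ℕ} {K : Type} [Fintype K] (i : Fin m)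
    (Λ : K → Op (Sys d) → Op (Sys d')) : Prop :=
  ∃ (h : ∀ j, j ≠ i → d' j = d j) (Φ : K → (Op (Fin (d i)) →ₗ[ℂ] Op (Fin (d' i)))),
    IsInstrument Φ ∧ ∀ k M, Λ k M = applyAt i h (Φ k) M

/-- `IsLOCC d d' K Λ`: the family `Λ k`, `k ∈ K`, of maps from operators on `X₁⋯Xₘ` (dimensions `d`)
to operators on `X₁⋯Xₘ` (dimensions `d'`) is realised by finitely many rounds of local operations
and classical communication, `k` being the classical outcome.
* `refl`: doing nothing;
* `step`: after a protocol with publicly announced outcome `k`, a party `i k` chosen according to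
  `k` performs an instrument `Φ k` chosen according to `k`, and announces its outcome;
* `forget`: part of the classical record is discarded, only `f k` being kept. -/
inductive IsLOCC {m : ℕ} (d : Fin m → ℕ) :
    (d' : Fin m → ℕ) → (K : Type) → [Fintype K] → (K → Op (Sys d) → Op (Sys d')) → Prop
  | refl : IsLOCC d d Unit (fun _ ρ => ρ)
  | step {d' d'' : Fin m → ℕ} {K : Type} [Fintype K] {Λ : K → Op (Sys d) → Op (Sys d')}
      {L : K → Type} [∀ k, Fintype (L k)] (i : K → Fin m)
      (Φ : ∀ k, L k → Op (Sys d') → Op (Sys d'')) :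
      IsLOCC d d' K Λ → (∀ k, IsUnilocalInstrument (i k) (Φ k)) →
      IsLOCC d d'' (Σ k, L k) (fun p ρ => Φ p.1 p.2 (Λ p.1 ρ))
  | forget {d' : Fin m → ℕ} {K L : Type} [Fintype K] [Fintype L] [DecidableEq L]
      {Λ : K → Op (Sys d) → Op (Sys d')} (f : K → L) :
      IsLOCC d d' K Λ → IsLOCC d d' L (fun l ρ => ∑ k with f k = l, Λ k ρ)

/-- Probability `p_k = Tr Λ_k(ρ)` of the outcome `k`. -/
def outcomeProb {m : ℕ} {d d' : Fin m → ℕ} {K : Type} (Λ : K → Op (Sys d) → Op (Sys d'))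
    (ρ : Op (Sys d)) (k : K) : ℝ :=
  (Λ k ρ).trace.re

/-- State `ρ_k = Λ_k(ρ) / p_k` after the outcome `k` (only meaningful if `p_k ≠ 0`). -/
def postState {m : ℕ} {d d' : Fin m → ℕ} {K : Type} (Λ : K → Op (Sys d) → Op (Sys d'))
    (ρ : Op (Sys d)) (k : K) : Op (Sys d') :=
  (outcomeProb Λ ρ k)⁻¹ • Λ k ρ

end SquashedEntanglement

end

open SquashedEntanglement

/-!
All entropic inequalities used here come from one variational formula. For positive operators `M`,
`N` with `ker N ⊆ ker M`, the scalar identity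
`p log p - p log q - p + q = ∫₀¹ (1 - s) (p - q)² / (s p + (1 - s) q) ds`, summed over eigenbases,
writes the relative entropy `D(M‖N)` as an integral over `s` of
`⟨K, (s L_M + (1 - s) R_N)⁻¹ K⟩` with `K = M - N` (`relEntropy_eq_integral`). This is the maximum
over `Z` of a quadratic functional `quadForm s M N Z` that is real-linear in `(M, N)`. Hence `D` is
jointly convex (use the same `Z` in every term), and it is monotone under Kraus operators `V l` with
`∑ V l† V l = 1` (replace the family `Z l` by `∑ V l† Z l V l` and use a Schwarz inequality).

Since `H(A|B) = -D(M‖1 ⊗ M_B)`, the conditional entropy is concave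
(`sum_condEntropy_le_condEntropy_sum`), and it does not decrease on average when the conditioning
system `B` is measured (`condEntropy_le_sum_condEntropy_conj`). Everything is stated for positive
operators without normalisation; all functionals are then homogeneous, and averages are sums.

For a party `i`,
`I(X₁;⋯;Xₘ|E) = ∑_{j ≠ i} H(Xⱼ|E) - H(X₁⋯X_{i-1}X_{i+1}⋯Xₘ|XᵢE)`. An instrument on `Xᵢ`, applied
to an extension, leaves the sum over the outcomes of the marginals on `XⱼE`, `j ≠ i`, unchanged, so
concavity bounds the first terms; it acts on the conditioning system of the last one, so data
processing bounds that. The conditional information therefore does not increase on average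
(`sum_condMultiInfo_applyAtProd_le`). Discarding the parties one by one shows that it is
nonnegative, so the infimum defining `Esq` is over a set bounded below.

Given extensions of operators `M k`, a classical flag `k` in the extending system turns them into an
extension of `∑ M k` with no more conditional information (`exists_flagged_extension`): this is
convexity. An LOCC protocol is a succession of unilocal instruments and of summations over a part of
the record, and the total squashed entanglement increases in neither.
-/

namespace SquashedEntanglement

open scoped ComplexOrder Matrix Kronecker

section

/-! ### An integral formula for the relative entropy -/

/-- Taylor's formula for `x log x`. An antiderivative of the integrand is `p log u - u`, where
`u = s p + (1 - s) q`. -/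
lemma klIntegrand_integral {p q : ℝ} (hp : 0 ≤ p) (hq : 0 ≤ q) (h : q = 0 → p = 0) :
    IntervalIntegrable (fun s => (1 - s) * ((p - q) ^ 2 / (s * p + (1 - s) * q)))
        MeasureTheory.volume 0 1 ∧
      ∫ s in (0 : ℝ)..1, (1 - s) * ((p - q) ^ 2 / (s * p + (1 - s) * q)) =
        p * Real.log p - p * Real.log q - p + q := by
  rcases hq.eq_or_lt with rfl | hq
  · obtain rfl := h rfl
    simp
  rcases hp.eq_or_lt with rfl | hp
  · -- only at the endpoint `s = 1`, of measure zero, does the integrand differ from `q`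
    have key : ∀ s ∈ Set.Ioo (0 : ℝ) 1,
        q = (1 - s) * ((0 - q) ^ 2 / (s * 0 + (1 - s) * q)) := by
      intro s hs
      have : 1 - s ≠ 0 := by linarith [hs.2]
      field_simp
      ring
    have key' : ∀ᵐ s ∂MeasureTheory.volume, s ∈ Set.uIoc (0 : ℝ) 1 →
        q = (1 - s) * ((0 - q) ^ 2 / (s * 0 + (1 - s) * q)) := by
      have : ∀ᵐ s ∂(MeasureTheory.volume : MeasureTheory.Measure ℝ), s ≠ 1 := by
        simp [MeasureTheory.ae_iff]
      filter_upwards [this] with s hs hs'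
      rw [Set.uIoc_of_le zero_le_one] at hs'
      exact key s ⟨hs'.1, lt_of_le_of_ne hs'.2 hs⟩
    refine ⟨(intervalIntegrable_const (c := q)).congr_ae ?_, ?_⟩
    · exact (MeasureTheory.ae_restrict_iff' measurableSet_uIoc).2 key'
    · rw [← intervalIntegral.integral_congr_ae key']
      simp
  have hpos : ∀ s ∈ Set.uIcc (0 : ℝ) 1, 0 < s * p + (1 - s) * q := by
    intro s hs
    rw [Set.uIcc_of_le zero_le_one] at hs
    rcases hs.1.eq_or_lt with rfl | h0
    · simpa using hq
    · have := mul_pos h0 hp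
      have := mul_nonneg (sub_nonneg.2 hs.2) hq.le
      linarith
  have hint : IntervalIntegrable (fun s => (1 - s) * ((p - q) ^ 2 / (s * p + (1 - s) * q)))
      MeasureTheory.volume 0 1 := by
    apply ContinuousOn.intervalIntegrable
    refine ContinuousOn.mul (by fun_prop) (ContinuousOn.div (by fun_prop) (by fun_prop) ?_)
    exact fun s hs => (hpos s hs).ne'
  refine ⟨hint, ?_⟩
  rw [intervalIntegral.integral_eq_sub_of_hasDerivAt
    (f := fun s => p * Real.log (s * p + (1 - s) * q) - (s * p + (1 - s) * q)) _ hint]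
  · simp
    ring
  · intro s hs
    have hu : HasDerivAt (fun s : ℝ => s * p + (1 - s) * q) (p - q) s := by
      have h1 := (hasDerivAt_id s).mul_const p
      have h2 := ((hasDerivAt_id s).const_sub 1).mul_const q
      exact (h1.add h2).congr_deriv (by ring)
    refine (((hu.log (hpos s hs).ne').const_mul p).sub hu).congr_deriv ?_
    obtain ⟨u, hu⟩ : ∃ u, u = s * p + (1 - s) * q := ⟨_, rfl⟩
    have hu0 : u ≠ 0 := hu ▸ (hpos s hs).ne'
    rw [← hu]
    field_simp
    rw [hu]
    ring

variable {n : Type} [Fintype n] [DecidableEq n]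

/-- Concave quadratic functional of `Z` whose maximum is
`⟨K, (s L_M + (1 - s) R_N)⁻¹ K⟩` with `K = M - N`, where `L_M` and `R_N` are left and right
multiplication. It is real-linear in the pair `(M, N)`. -/
noncomputable def quadForm (s : ℝ) (M N Z : Op n) : ℝ :=
  2 * (Zᴴ * (M - N)).trace.re - s * (Zᴴ * M * Z).trace.re - (1 - s) * (Z * N * Zᴴ).trace.re

/-- Relative entropy, in nats, of two positive operators, not necessarily normalised, with the term
`Tr N - Tr M` that makes it nonnegative. -/
noncomputable def relEntropy (M N : Op n) : ℝ :=
  (M * cfc Real.log M).trace.re - (M * cfc Real.log N).trace.re - M.trace.re + N.trace.re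

/-- Transition amplitudes between the eigenbases of two Hermitian matrices. -/
noncomputable def overlap {M N : Op n} (hM : M.IsHermitian) (hN : N.IsHermitian) : Op n :=
  (hM.eigenvectorUnitary : Op n)ᴴ * (hN.eigenvectorUnitary : Op n)

lemma trace_mul_eq_sum {n : Type} [Fintype n] (A B : Op n) :
    (A * B).trace = ∑ i, ∑ j, A i j * B j i := by
  simp [Matrix.trace, Matrix.mul_apply]

lemma eigenvectorUnitary_conjTranspose_mul {M : Op n} (hM : M.IsHermitian) :
    (hM.eigenvectorUnitary : Op n)ᴴ * (hM.eigenvectorUnitary : Op n) = 1 :=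
  Unitary.coe_star_mul_self hM.eigenvectorUnitary

lemma eigenvectorUnitary_mul_conjTranspose {M : Op n} (hM : M.IsHermitian) :
    (hM.eigenvectorUnitary : Op n) * (hM.eigenvectorUnitary : Op n)ᴴ = 1 :=
  Unitary.coe_mul_star_self hM.eigenvectorUnitary

lemma cfc_eq_conj_diagonal {M : Op n} (hM : M.IsHermitian) (f : ℝ → ℝ) :
    cfc f M = (hM.eigenvectorUnitary : Op n) *
      Matrix.diagonal (fun i => ((f (hM.eigenvalues i) : ℝ) : ℂ)) *
        (hM.eigenvectorUnitary : Op n)ᴴ := by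
  rw [hM.cfc_eq, Matrix.IsHermitian.cfc, Unitary.conjStarAlgAut_apply]
  rfl

lemma eq_conj_diagonal {M : Op n} (hM : M.IsHermitian) :
    M = (hM.eigenvectorUnitary : Op n) *
      Matrix.diagonal (fun i => ((hM.eigenvalues i : ℝ) : ℂ)) *
        (hM.eigenvectorUnitary : Op n)ᴴ := by
  conv_lhs => rw [hM.spectral_theorem, Unitary.conjStarAlgAut_apply]
  rfl

lemma trace_mul_cfc_re {M N : Op n} (hM : M.IsHermitian) (hN : N.IsHermitian) (f : ℝ → ℝ) :
    (M * cfc f N).trace.re =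
      ∑ i, ∑ j, hM.eigenvalues i * f (hN.eigenvalues j) * Complex.normSq (overlap hM hN i j) := by
  set U := (hM.eigenvectorUnitary : Op n)
  set W := (hN.eigenvectorUnitary : Op n)
  set D : Op n := Matrix.diagonal (fun i => ((hM.eigenvalues i : ℝ) : ℂ)) with hD
  set F : Op n := Matrix.diagonal (fun i => ((f (hN.eigenvalues i) : ℝ) : ℂ)) with hF
  have h1 : M * cfc f N = U * (D * (Uᴴ * W) * F * Wᴴ) := by
    rw [cfc_eq_conj_diagonal hN f]
    conv_lhs => rw [eq_conj_diagonal hM]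
    simp only [Matrix.mul_assoc, U, W, D, F]
  have h2 : (D * (Uᴴ * W) * F * Wᴴ) * U = D * (Uᴴ * W) * F * (Uᴴ * W)ᴴ := by
    simp [Matrix.mul_assoc, Matrix.conjTranspose_mul]
  rw [h1, Matrix.trace_mul_comm, h2]
  change (D * overlap hM hN * F * (overlap hM hN)ᴴ).trace.re = _
  simp only [trace_mul_eq_sum, hD, hF, Matrix.diagonal_mul, Matrix.mul_diagonal,
    Matrix.conjTranspose_apply, Complex.re_sum]
  refine Finset.sum_congr rfl fun i _ => Finset.sum_congr rfl fun j _ => ?_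
  simp [Complex.normSq_apply, Complex.mul_re, Complex.mul_im]
  ring

lemma sum_normSq_overlap_right {M N : Op n} (hM : M.IsHermitian) (hN : N.IsHermitian) (i : n) :
    ∑ j, Complex.normSq (overlap hM hN i j) = 1 := by
  have h : overlap hM hN * (overlap hM hN)ᴴ = 1 := by
    rw [overlap, Matrix.conjTranspose_mul, Matrix.conjTranspose_conjTranspose, Matrix.mul_assoc,
      ← Matrix.mul_assoc _ _ (hM.eigenvectorUnitary : Op n), eigenvectorUnitary_mul_conjTranspose,
      Matrix.one_mul, eigenvectorUnitary_conjTranspose_mul]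
  have := congrArg Complex.re (congrFun (congrFun h i) i)
  simpa [Matrix.mul_apply, Complex.normSq_apply] using this

lemma sum_normSq_overlap_left {M N : Op n} (hM : M.IsHermitian) (hN : N.IsHermitian) (j : n) :
    ∑ i, Complex.normSq (overlap hM hN i j) = 1 := by
  have h : (overlap hM hN)ᴴ * overlap hM hN = 1 := by
    rw [overlap, Matrix.conjTranspose_mul, Matrix.conjTranspose_conjTranspose, Matrix.mul_assoc,
      ← Matrix.mul_assoc _ _ (hN.eigenvectorUnitary : Op n), eigenvectorUnitary_mul_conjTranspose,
      Matrix.one_mul, eigenvectorUnitary_conjTranspose_mul]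
  have := congrArg Complex.re (congrFun (congrFun h j) j)
  simpa [Matrix.mul_apply, Complex.normSq_apply] using this

lemma trace_re_eq_sum_eigenvalues {M : Op n} (hM : M.IsHermitian) :
    M.trace.re = ∑ i, hM.eigenvalues i := by
  rw [hM.trace_eq_sum_eigenvalues]
  simp

/-- `⟨K, (s L_M + (1 - s) R_N)⁻¹ K⟩` with `K = M - N`, written in the eigenbases of `M`
and `N`. -/
noncomputable def resolventForm {M N : Op n} (hM : M.IsHermitian) (hN : N.IsHermitian)
    (s : ℝ) : ℝ :=
  ∑ i, ∑ j, (hM.eigenvalues i - hN.eigenvalues j) ^ 2 /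
    (s * hM.eigenvalues i + (1 - s) * hN.eigenvalues j) * Complex.normSq (overlap hM hN i j)

lemma quadForm_eq_sum {M N : Op n} (hM : M.IsHermitian) (hN : N.IsHermitian) (s : ℝ) (Y : Op n) :
    quadForm s M N ((hM.eigenvectorUnitary : Op n) * Y * (hN.eigenvectorUnitary : Op n)ᴴ) =
      ∑ i, ∑ j, (2 * (hM.eigenvalues i - hN.eigenvalues j) *
          (star (Y i j) * overlap hM hN i j).re -
        (s * hM.eigenvalues i + (1 - s) * hN.eigenvalues j) * Complex.normSq (Y i j)) := by
  have hU := eigenvectorUnitary_conjTranspose_mul hM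
  have hW := eigenvectorUnitary_conjTranspose_mul hN
  have eM := eq_conj_diagonal hM
  have eN := eq_conj_diagonal hN
  have eT : overlap hM hN = (hM.eigenvectorUnitary : Op n)ᴴ * (hN.eigenvectorUnitary : Op n) := rfl
  set U := (hM.eigenvectorUnitary : Op n)
  set W := (hN.eigenvectorUnitary : Op n)
  set T := overlap hM hN
  set D : Op n := Matrix.diagonal (fun i => ((hM.eigenvalues i : ℝ) : ℂ)) with hD
  set F : Op n := Matrix.diagonal (fun i => ((hN.eigenvalues i : ℝ) : ℂ)) with hF
  have hU' : ∀ X : Op n, Uᴴ * (U * X) = X := fun X => by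
    rw [← Matrix.mul_assoc, hU, Matrix.one_mul]
  have hW' : ∀ X : Op n, Wᴴ * (W * X) = X := fun X => by
    rw [← Matrix.mul_assoc, hW, Matrix.one_mul]
  have e1 : ((U * Y * Wᴴ)ᴴ * (M - N)).trace = (Yᴴ * (D * T - T * F)).trace := by
    have : (U * Y * Wᴴ)ᴴ * (M - N) = W * (Yᴴ * (Uᴴ * M - Uᴴ * N)) := by
      simp only [Matrix.conjTranspose_mul, Matrix.conjTranspose_conjTranspose, Matrix.mul_assoc,
        Matrix.mul_sub]
    rw [this, Matrix.trace_mul_comm, Matrix.mul_assoc, Matrix.sub_mul]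
    conv_lhs => rw [eM, eN]
    simp only [Matrix.mul_assoc, hU', hW, eT, Matrix.mul_one]
  have e2 : ((U * Y * Wᴴ)ᴴ * M * (U * Y * Wᴴ)).trace = (Yᴴ * (D * Y)).trace := by
    have : (U * Y * Wᴴ)ᴴ * M * (U * Y * Wᴴ) = W * (Yᴴ * (D * Y) * Wᴴ) := by
      conv_lhs => rw [eM]
      simp only [Matrix.conjTranspose_mul, Matrix.conjTranspose_conjTranspose, Matrix.mul_assoc,
        hU']
    rw [this, Matrix.trace_mul_comm, Matrix.mul_assoc, hW, Matrix.mul_one]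
  have e3 : ((U * Y * Wᴴ) * N * (U * Y * Wᴴ)ᴴ).trace = (Y * F * Yᴴ).trace := by
    have : (U * Y * Wᴴ) * N * (U * Y * Wᴴ)ᴴ = U * (Y * F * Yᴴ * Uᴴ) := by
      conv_lhs => rw [eN]
      simp only [Matrix.conjTranspose_mul, Matrix.conjTranspose_conjTranspose, Matrix.mul_assoc,
        hW']
    rw [this, Matrix.trace_mul_comm, Matrix.mul_assoc, hU, Matrix.mul_one]
  rw [quadForm, e1, e2, e3, Matrix.trace_mul_comm Yᴴ, Matrix.trace_mul_comm Yᴴ]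
  simp only [trace_mul_eq_sum, hD, hF, Matrix.diagonal_mul, Matrix.mul_diagonal,
    Matrix.conjTranspose_apply, Complex.re_sum, Matrix.sub_apply,
    Finset.mul_sum, ← Finset.sum_sub_distrib]
  refine Finset.sum_congr rfl fun i _ => Finset.sum_congr rfl fun j _ => ?_
  simp [Complex.normSq_apply, Complex.mul_re, Complex.mul_im]
  ring

/-- The maximum of `quadForm` is attained at `Z = (s L_M + (1 - s) R_N)⁻¹ (M - N)`. -/
lemma exists_quadForm_eq_resolventForm {M N : Op n} (hM : M.PosSemidef) (hN : N.PosSemidef)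
    (s : ℝ) : ∃ Z, quadForm s M N Z = resolventForm hM.1 hN.1 s := by
  refine ⟨(hM.1.eigenvectorUnitary : Op n) * (Matrix.of fun i j =>
    (((hM.1.eigenvalues i - hN.1.eigenvalues j) /
      (s * hM.1.eigenvalues i + (1 - s) * hN.1.eigenvalues j) : ℝ) : ℂ) *
        overlap hM.1 hN.1 i j) * (hN.1.eigenvectorUnitary : Op n)ᴴ, ?_⟩
  rw [quadForm_eq_sum, resolventForm]
  refine Finset.sum_congr rfl fun i _ => Finset.sum_congr rfl fun j _ => ?_
  simp only [Matrix.of_apply]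
  set p := hM.1.eigenvalues i
  set q := hN.1.eigenvalues j
  by_cases hc : s * p + (1 - s) * q = 0
  · simp [hc]
  · generalize overlap hM.1 hN.1 i j = t
    have e : (star (((p - q) / (s * p + (1 - s) * q) : ℝ) * t : ℂ) * t).re =
        (p - q) / (s * p + (1 - s) * q) * Complex.normSq t := by
      simp only [Complex.star_def, Complex.normSq_apply, Complex.mul_re, Complex.mul_im,
        Complex.conj_re, Complex.conj_im, Complex.ofReal_re, Complex.ofReal_im]
      ring
    rw [e, map_mul, Complex.normSq_ofReal]
    field_simp
    ring

/-- In the eigenbases the functional splits into a sum over the entries `i j`, in each of which the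
bound is a completed square. -/
lemma quadForm_le_resolventForm {M N : Op n} (hM : M.PosSemidef) (hN : N.PosSemidef)
    {s : ℝ} (hs : s ∈ Set.Ioo (0 : ℝ) 1) (Z : Op n) :
    quadForm s M N Z ≤ resolventForm hM.1 hN.1 s := by
  obtain ⟨Y, rfl⟩ : ∃ Y, Z =
      (hM.1.eigenvectorUnitary : Op n) * Y * (hN.1.eigenvectorUnitary : Op n)ᴴ := by
    refine ⟨(hM.1.eigenvectorUnitary : Op n)ᴴ * Z * (hN.1.eigenvectorUnitary : Op n), ?_⟩
    rw [Matrix.mul_assoc, Matrix.mul_assoc, eigenvectorUnitary_mul_conjTranspose, Matrix.mul_one,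
      ← Matrix.mul_assoc, eigenvectorUnitary_mul_conjTranspose, Matrix.one_mul]
  rw [quadForm_eq_sum, resolventForm]
  refine Finset.sum_le_sum fun i _ => Finset.sum_le_sum fun j _ => ?_
  have hp := hM.eigenvalues_nonneg i
  have hq := hN.eigenvalues_nonneg j
  set p := hM.1.eigenvalues i
  set q := hN.1.eigenvalues j
  set t := overlap hM.1 hN.1 i j
  have h1 := mul_nonneg hs.1.le hp
  have h2 := mul_nonneg (sub_nonneg.2 hs.2.le) hq
  rcases (add_nonneg h1 h2).eq_or_lt with hc | hc
  · -- the denominator vanishes only for `p = q = 0`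
    have hp0 : p = 0 := by
      have : s * p = 0 := by linarith
      exact (mul_eq_zero.1 this).resolve_left hs.1.ne'
    have hq0 : q = 0 := by
      have : (1 - s) * q = 0 := by linarith
      exact (mul_eq_zero.1 this).resolve_left (sub_pos.2 hs.2).ne'
    simp [hp0, hq0]
  · rw [div_mul_eq_mul_div, le_div_iff₀ hc]
    simp only [Complex.normSq_apply, Complex.star_def, Complex.mul_re, Complex.conj_re,
      Complex.conj_im]
    nlinarith [sq_nonneg ((s * p + (1 - s) * q) * (Y i j).re - (p - q) * t.re),
      sq_nonneg ((s * p + (1 - s) * q) * (Y i j).im - (p - q) * t.im)]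

/-- If the kernel of `N` is contained in that of `M`, the eigenvectors of `N` with eigenvalue `0`
are orthogonal to those of `M` with nonzero eigenvalue. -/
lemma overlap_eq_zero {M N : Op n} (hM : M.IsHermitian) (hN : N.IsHermitian)
    (hker : ∀ v, N.mulVec v = 0 → M.mulVec v = 0) {i j : n} (hj : hN.eigenvalues j = 0)
    (hi : hM.eigenvalues i ≠ 0) : overlap hM hN i j = 0 := by
  set U := (hM.eigenvectorUnitary : Op n) with hU
  set W := (hN.eigenvectorUnitary : Op n) with hW
  have h1 : N.mulVec (W.col j) = 0 := by
    have := hN.mulVec_eigenvectorBasis j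
    rw [hj, zero_smul] at this
    exact this
  have h2 := hker _ h1
  have h3 : Uᴴ * M = Matrix.diagonal (fun i => ((hM.eigenvalues i : ℝ) : ℂ)) * Uᴴ := by
    conv_lhs => rw [eq_conj_diagonal hM]
    rw [Matrix.mul_assoc, ← Matrix.mul_assoc, ← hU, hU, eigenvectorUnitary_conjTranspose_mul,
      Matrix.one_mul]
  have h4 : (Uᴴ * M).mulVec (W.col j) = 0 := by
    rw [← Matrix.mulVec_mulVec, h2, Matrix.mulVec_zero]
  rw [h3, ← Matrix.mulVec_mulVec] at h4
  have h5 := congrFun h4 i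
  rw [Matrix.mulVec_diagonal] at h5
  have h6 : (Uᴴ.mulVec (W.col j)) i = overlap hM hN i j := by
    simp [overlap, Matrix.mulVec, dotProduct, Matrix.mul_apply, hU, hW]
  rw [h6] at h5
  exact (mul_eq_zero.1 h5).resolve_left (by exact_mod_cast hi)

theorem relEntropy_eq_integral {M N : Op n} (hM : M.PosSemidef) (hN : N.PosSemidef)
    (hker : ∀ v, N.mulVec v = 0 → M.mulVec v = 0) :
    IntervalIntegrable (fun s => (1 - s) * resolventForm hM.1 hN.1 s) MeasureTheory.volume 0 1 ∧
      relEntropy M N = ∫ s in (0 : ℝ)..1, (1 - s) * resolventForm hM.1 hN.1 s := by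
  have key : ∀ i j,
      IntervalIntegrable (fun s => (1 - s) * ((hM.1.eigenvalues i - hN.1.eigenvalues j) ^ 2 /
        (s * hM.1.eigenvalues i + (1 - s) * hN.1.eigenvalues j)) *
          Complex.normSq (overlap hM.1 hN.1 i j)) MeasureTheory.volume 0 1 ∧
      ∫ s in (0 : ℝ)..1, (1 - s) * ((hM.1.eigenvalues i - hN.1.eigenvalues j) ^ 2 /
        (s * hM.1.eigenvalues i + (1 - s) * hN.1.eigenvalues j)) *
          Complex.normSq (overlap hM.1 hN.1 i j) =
      (hM.1.eigenvalues i * Real.log (hM.1.eigenvalues i) -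
        hM.1.eigenvalues i * Real.log (hN.1.eigenvalues j) - hM.1.eigenvalues i +
          hN.1.eigenvalues j) * Complex.normSq (overlap hM.1 hN.1 i j) := by
    intro i j
    by_cases h : hN.1.eigenvalues j = 0 → hM.1.eigenvalues i = 0
    · obtain ⟨h1, h2⟩ := klIntegrand_integral (hM.eigenvalues_nonneg i) (hN.eigenvalues_nonneg j) h
      exact ⟨h1.mul_const _, by rw [intervalIntegral.integral_mul_const, h2]⟩
    · -- here the scalar integral diverges, but the overlap vanishes
      push Not at h
      simp [overlap_eq_zero hM.1 hN.1 hker h.1 h.2]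
  have hform : (fun s => (1 - s) * resolventForm hM.1 hN.1 s) = fun s => ∑ i, ∑ j,
      (1 - s) * ((hM.1.eigenvalues i - hN.1.eigenvalues j) ^ 2 /
        (s * hM.1.eigenvalues i + (1 - s) * hN.1.eigenvalues j)) *
          Complex.normSq (overlap hM.1 hN.1 i j) := by
    funext s
    simp only [resolventForm, Finset.mul_sum, mul_assoc]
  have hint : ∀ i, IntervalIntegrable (fun s => ∑ j,
      (1 - s) * ((hM.1.eigenvalues i - hN.1.eigenvalues j) ^ 2 /
        (s * hM.1.eigenvalues i + (1 - s) * hN.1.eigenvalues j)) *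
          Complex.normSq (overlap hM.1 hN.1 i j)) MeasureTheory.volume 0 1 := by
    intro i
    have := IntervalIntegrable.sum Finset.univ fun j _ => (key i j).1
    simpa only [Finset.sum_fn] using this
  rw [hform]
  constructor
  · have := IntervalIntegrable.sum Finset.univ fun i _ => hint i
    simpa only [Finset.sum_fn] using this
  · rw [intervalIntegral.integral_finsetSum fun i _ => hint i]
    simp_rw [intervalIntegral.integral_finsetSum fun j _ => (key _ j).1, (key _ _).2]
    have e1 : (M * cfc Real.log M).trace.re = ∑ i, ∑ j, hM.1.eigenvalues i *
        Real.log (hM.1.eigenvalues i) * Complex.normSq (overlap hM.1 hN.1 i j) := by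
      rw [trace_mul_cfc_re hM.1 hM.1]
      refine Finset.sum_congr rfl fun i _ => ?_
      have : overlap hM.1 hM.1 = 1 := eigenvectorUnitary_conjTranspose_mul hM.1
      rw [← Finset.mul_sum, sum_normSq_overlap_right, this]
      simp [Matrix.one_apply, apply_ite Complex.normSq]
    have e3 : M.trace.re = ∑ i, ∑ j, hM.1.eigenvalues i *
        Complex.normSq (overlap hM.1 hN.1 i j) := by
      simp only [← Finset.mul_sum, sum_normSq_overlap_right, mul_one]
      exact trace_re_eq_sum_eigenvalues hM.1
    have e4 : N.trace.re = ∑ i, ∑ j, hN.1.eigenvalues j *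
        Complex.normSq (overlap hM.1 hN.1 i j) := by
      rw [Finset.sum_comm]
      simp only [← Finset.mul_sum, sum_normSq_overlap_left, mul_one]
      exact trace_re_eq_sum_eigenvalues hN.1
    rw [relEntropy, e1, trace_mul_cfc_re hM.1 hN.1, e3, e4]
    simp only [← Finset.sum_sub_distrib, ← Finset.sum_add_distrib]
    refine Finset.sum_congr rfl fun i _ => Finset.sum_congr rfl fun j _ => ?_
    ring

/-- Monotonicity of the relative entropy, reduced to its variational form: an inequality between
sums of relative entropies follows from one between the quadratic functionals of which the
integrands are maxima. -/
theorem sum_relEntropy_le_sum_relEntropy {J K : Type} [Fintype J] [Fintype K] {a : K → Type}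
    {b : J → Type} [∀ k, Fintype (a k)] [∀ k, DecidableEq (a k)] [∀ j, Fintype (b j)]
    [∀ j, DecidableEq (b j)] {M N : ∀ k, Op (a k)} {M' N' : ∀ j, Op (b j)}
    (hM : ∀ k, (M k).PosSemidef) (hN : ∀ k, (N k).PosSemidef)
    (hker : ∀ k v, (N k).mulVec v = 0 → (M k).mulVec v = 0)
    (hM' : ∀ j, (M' j).PosSemidef) (hN' : ∀ j, (N' j).PosSemidef)
    (hker' : ∀ j v, (N' j).mulVec v = 0 → (M' j).mulVec v = 0)
    (h : ∀ s ∈ Set.Ioo (0 : ℝ) 1, ∀ Z : ∀ k, Op (a k), ∃ Z' : ∀ j, Op (b j),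
      ∑ k, quadForm s (M k) (N k) (Z k) ≤ ∑ j, quadForm s (M' j) (N' j) (Z' j)) :
    ∑ k, relEntropy (M k) (N k) ≤ ∑ j, relEntropy (M' j) (N' j) := by
  have i1 : ∀ k, _ := fun k => relEntropy_eq_integral (hM k) (hN k) (hker k)
  have i2 : ∀ j, _ := fun j => relEntropy_eq_integral (hM' j) (hN' j) (hker' j)
  simp_rw [(i1 _).2, (i2 _).2]
  rw [← intervalIntegral.integral_finsetSum fun k _ => (i1 k).1,
    ← intervalIntegral.integral_finsetSum fun j _ => (i2 j).1]
  refine intervalIntegral.integral_mono_on_of_le_Ioo zero_le_one ?_ ?_ fun s hs => ?_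
  · have := IntervalIntegrable.sum Finset.univ fun k _ => (i1 k).1
    simpa only [Finset.sum_fn] using this
  · have := IntervalIntegrable.sum Finset.univ fun j _ => (i2 j).1
    simpa only [Finset.sum_fn] using this
  · rw [← Finset.mul_sum, ← Finset.mul_sum]
    refine mul_le_mul_of_nonneg_left ?_ (sub_nonneg.2 hs.2.le)
    choose Z hZ using fun k => exists_quadForm_eq_resolventForm (hM k) (hN k) s
    obtain ⟨Z', hZ'⟩ := h s hs Z
    calc _ = ∑ k, quadForm s (M k) (N k) (Z k) := by simp_rw [hZ]
      _ ≤ _ := hZ'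
      _ ≤ _ := Finset.sum_le_sum fun j _ => quadForm_le_resolventForm (hM' j) (hN' j) hs _

end

/-! ### Functional calculus and entropy -/

lemma continuousOn_spectrum {a : Type} [Fintype a] [DecidableEq a] (M : Op a) (f : ℝ → ℝ) :
    ContinuousOn f (spectrum ℝ M) :=
  (Matrix.finite_real_spectrum (A := M)).continuousOn f

lemma map_cfc_of_isHermitian {a b : Type} [Fintype a] [DecidableEq a] [Fintype b] [DecidableEq b]
    (φ : Op a →⋆ₐ[ℝ] Op b) (f : ℝ → ℝ) {M : Op a} (hM : M.IsHermitian) :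
    cfc f (φ M) = φ (cfc f M) := by
  have hM' : IsSelfAdjoint M := hM
  exact (φ.map_cfc f M (continuousOn_spectrum M f)
    (LinearMap.continuous_of_finiteDimensional φ.toLinearMap) hM' (hM'.map φ)).symm

/-- The embedding `A ↦ 1 ⊗ A`. -/
def oneKronecker (a : Type) {b : Type} [Fintype a] [DecidableEq a] [Fintype b] [DecidableEq b] :
    Op b →⋆ₐ[ℝ] Op (a × b) where
  toFun A := (1 : Op a) ⊗ₖ A
  map_one' := Matrix.one_kronecker_one
  map_mul' A B := by rw [← Matrix.mul_kronecker_mul, Matrix.one_mul]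
  map_zero' := Matrix.kronecker_zero _
  map_add' A B := Matrix.kronecker_add _ _ _
  commutes' r := by
    rw [Algebra.algebraMap_eq_smul_one, Matrix.kronecker_smul, Matrix.one_kronecker_one,
      Algebra.algebraMap_eq_smul_one]
  map_star' A := by
    simp [Matrix.star_eq_conjTranspose, Matrix.conjTranspose_kronecker]

/-- Relabelling of the basis. -/
def relabel {a b : Type} [Fintype a] [DecidableEq a] [Fintype b] [DecidableEq b] (e : b ≃ a) :
    Op a →⋆ₐ[ℝ] Op b where
  toFun A := A.submatrix e e
  map_one' := Matrix.submatrix_one_equiv e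
  map_mul' A B := (Matrix.submatrix_mul_equiv A B e e e).symm
  map_zero' := rfl
  map_add' _ _ := rfl
  commutes' r := by
    rw [Algebra.algebraMap_eq_smul_one, Matrix.submatrix_smul, Pi.smul_apply, Pi.smul_apply,
      Matrix.submatrix_one_equiv, Algebra.algebraMap_eq_smul_one]
  map_star' _ := rfl

lemma trace_submatrix_equiv {a b : Type} [Fintype a] [Fintype b] (e : b ≃ a) (M : Op a) :
    (M.submatrix e e).trace = M.trace :=
  Fintype.sum_equiv e _ _ fun _ => rfl

lemma entropy_submatrix_equiv {a b : Type} [Fintype a] [DecidableEq a] [Fintype b] [DecidableEq b]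
    (e : b ≃ a) {M : Op a} (hM : M.IsHermitian) : entropy (M.submatrix e e) = entropy M := by
  have h := map_cfc_of_isHermitian (relabel e) (Real.logb 2) hM
  change cfc (Real.logb 2) (M.submatrix e e) = (cfc (Real.logb 2) M).submatrix e e at h
  rw [entropy, entropy, h, Matrix.submatrix_mul_equiv, trace_submatrix_equiv]

section

variable {a b : Type}

lemma cfc_logb_two [Fintype a] [DecidableEq a] {M : Op a} :
    cfc (Real.logb 2) M = (Real.log 2)⁻¹ • cfc Real.log M := by
  rw [← cfc_smul _ _ _ (continuousOn_spectrum M _)]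
  congr 1
  funext x
  rw [Real.logb, smul_eq_mul, div_eq_inv_mul]

lemma entropy_eq_log [Fintype a] [DecidableEq a] (M : Op a) :
    entropy M = -((Real.log 2)⁻¹ * (M * cfc Real.log M).trace.re) := by
  rw [entropy, cfc_logb_two, Matrix.mul_smul, Matrix.trace_smul, Complex.smul_re, smul_eq_mul]

lemma entropy_smul [Fintype a] [DecidableEq a] {M : Op a} (hM : M.IsHermitian) (c : ℝ) :
    entropy (c • M) = c * entropy M - c * Real.logb 2 c * M.trace.re := by
  have hM' : IsSelfAdjoint M := hM
  rcases eq_or_ne c 0 with rfl | hc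
  · simp [entropy]
  have key : ∀ N : Op a, IsSelfAdjoint N →
      N * cfc (Real.logb 2) N = cfc (fun x => x * Real.logb 2 x) N := fun N hN => by
    rw [cfc_mul (fun x => x) _ N (continuousOn_spectrum N _) (continuousOn_spectrum N _),
      cfc_id' ℝ N]
  have hcM : IsSelfAdjoint (c • M) := (IsSelfAdjoint.all c).smul hM'
  have e1 : cfc (fun x => x * Real.logb 2 x) (c • M) =
      cfc (fun x => c * (x * Real.logb 2 x) + c * Real.logb 2 c * x) M := by
    rw [← cfc_comp_smul c _ M ((Matrix.finite_real_spectrum.image _).continuousOn _)]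
    congr 1
    funext x
    rcases eq_or_ne x 0 with rfl | hx
    · simp
    · rw [smul_eq_mul, Real.logb_mul hc hx]
      ring
  have e2 : cfc (fun x => c * (x * Real.logb 2 x) + c * Real.logb 2 c * x) M =
      c • cfc (fun x => x * Real.logb 2 x) M + (c * Real.logb 2 c) • M := by
    rw [cfc_add _ _ _ (continuousOn_spectrum M _) (continuousOn_spectrum M _),
      cfc_const_mul _ _ _ (continuousOn_spectrum M _),
      cfc_const_mul _ _ _ (continuousOn_spectrum M _), cfc_id' ℝ M]
  rw [entropy, entropy, key _ hcM, key _ hM', e1, e2, Matrix.trace_add, Matrix.trace_smul,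
    Matrix.trace_smul, Complex.add_re, Complex.smul_re, Complex.smul_re, smul_eq_mul, smul_eq_mul]
  ring

/-! ### Conditional entropy -/

lemma trace_traceLeft [Fintype a] [Fintype b] (M : Op (a × b)) : (traceLeft M).trace = M.trace := by
  simp only [traceLeft, Matrix.trace, Matrix.diag, Matrix.of_apply, Fintype.sum_prod_type]
  exact Finset.sum_comm

lemma trace_traceRight [Fintype a] [Fintype b] (M : Op (a × b)) :
    (traceRight M).trace = M.trace := by
  simp only [traceRight, Matrix.trace, Matrix.diag, Matrix.of_apply, Fintype.sum_prod_type]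

lemma traceLeft_eq_sum [Fintype a] (M : Op (a × b)) :
    traceLeft M = ∑ s, M.submatrix (fun e => (s, e)) (fun e => (s, e)) := by
  ext e f
  simp [traceLeft, Matrix.sum_apply]

lemma posSemidef_traceLeft [Fintype a] {M : Op (a × b)} (hM : M.PosSemidef) :
    (traceLeft M).PosSemidef := by
  rw [traceLeft_eq_sum]
  exact Matrix.posSemidef_sum _ fun s _ => hM.submatrix _

lemma posSemidef_traceRight [Fintype b] {M : Op (a × b)} (hM : M.PosSemidef) :
    (traceRight M).PosSemidef := by
  have : traceRight M = ∑ e, M.submatrix (fun s => (s, e)) (fun s => (s, e)) := by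
    ext s t
    simp [traceRight, Matrix.sum_apply]
  rw [this]
  exact Matrix.posSemidef_sum _ fun s _ => hM.submatrix _

lemma trace_mul_one_kronecker [Fintype a] [DecidableEq a] [Fintype b] (M : Op (a × b)) (L : Op b) :
    (M * ((1 : Op a) ⊗ₖ L)).trace = (traceLeft M * L).trace := by
  simp only [trace_mul_eq_sum, traceLeft, Matrix.of_apply, Matrix.kroneckerMap_apply,
    Matrix.one_apply, Fintype.sum_prod_type, ite_mul, one_mul, zero_mul, mul_ite, mul_zero,
    Finset.sum_mul]
  simp only [Finset.sum_ite_irrel, Finset.sum_const_zero, Finset.sum_ite_eq', Finset.mem_univ,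
    if_true]
  rw [Finset.sum_comm]
  refine Finset.sum_congr rfl fun e _ => Finset.sum_comm

/-- The kernel of `1 ⊗ Tr₁ M` is contained in that of `M`. -/
lemma mulVec_eq_zero_of_one_kronecker_traceLeft [Fintype a] [DecidableEq a] [Fintype b] {M : Op
    (a × b)} (hM : M.PosSemidef)
    (v : a × b → ℂ) (hv : ((1 : Op a) ⊗ₖ traceLeft M).mulVec v = 0) : M.mulVec v = 0 := by
  -- `w r t` is the vector `|t⟩ ⊗ v_r`, where `v = ∑ r, |r⟩ ⊗ v_r`
  set w : a → a → a × b → ℂ := fun r t p => if p.1 = t then v (r, p.2) else 0 with hw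
  have h1 : ∀ r, (traceLeft M).mulVec (fun e => v (r, e)) = 0 := by
    intro r
    funext e
    have := congrFun hv (r, e)
    simpa [Matrix.mulVec, dotProduct, Fintype.sum_prod_type, Matrix.one_apply, ite_mul] using this
  have h2 : ∀ r, ∑ t, star (w r t) ⬝ᵥ M.mulVec (w r t) = 0 := by
    intro r
    have h3 : star (fun e => v (r, e)) ⬝ᵥ (traceLeft M).mulVec (fun e => v (r, e)) = 0 := by
      rw [h1, dotProduct_zero]
    rw [traceLeft_eq_sum, Matrix.sum_mulVec, dotProduct_sum] at h3
    rw [← h3]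
    refine Finset.sum_congr rfl fun t _ => ?_
    simp only [dotProduct, Matrix.mulVec, Fintype.sum_prod_type, Pi.star_apply, hw, apply_ite star,
      star_zero, ite_mul, zero_mul, mul_ite, mul_zero, Matrix.submatrix_apply]
    simp [Finset.sum_ite_irrel]
  have h3 : ∀ r t, M.mulVec (w r t) = 0 := by
    intro r t
    have := (Finset.sum_eq_zero_iff_of_nonneg
      fun t _ => hM.dotProduct_mulVec_nonneg (w r t)).1 (h2 r) t (Finset.mem_univ t)
    exact (hM.dotProduct_mulVec_zero_iff _).1 this
  have h4 : v = ∑ r, w r r := by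
    funext p
    simp [hw, Finset.sum_apply]
  rw [h4, Matrix.mulVec_sum]
  exact Finset.sum_eq_zero fun r _ => h3 r r

lemma posSemidef_one_kronecker [Fintype a] [DecidableEq a] [Fintype b] {A : Op b} (hA :
    A.PosSemidef) :
    ((1 : Op a) ⊗ₖ A).PosSemidef :=
  Matrix.PosSemidef.one.kronecker hA

/-- `H(A|B) = -D(M‖1 ⊗ M_B)` in bits. The last summand cancels the trace terms of
`relEntropy`. -/
lemma condEntropy_eq_relEntropy [Fintype a] [DecidableEq a] [Fintype b] [DecidableEq b] {M : Op
    (a × b)} (hM : M.PosSemidef) :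
    condEntropy M = -(Real.log 2)⁻¹ *
      (relEntropy M ((1 : Op a) ⊗ₖ traceLeft M) + (1 - Fintype.card a) * M.trace.re) := by
  have h := map_cfc_of_isHermitian (oneKronecker a) Real.log (posSemidef_traceLeft hM).1
  change cfc Real.log ((1 : Op a) ⊗ₖ traceLeft M) =
    (1 : Op a) ⊗ₖ cfc Real.log (traceLeft M) at h
  rw [condEntropy, entropy_eq_log, entropy_eq_log, relEntropy, h, trace_mul_one_kronecker,
    Matrix.trace_kronecker, trace_traceLeft, Matrix.trace_one]
  simp only [Complex.mul_re, Complex.natCast_re, Complex.natCast_im]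
  ring

lemma condEntropy_smul [Fintype a] [DecidableEq a] [Fintype b] [DecidableEq b] {M : Op (a × b)}
    (hM : M.PosSemidef) (c : ℝ) :
    condEntropy (c • M) = c * condEntropy M := by
  have h : traceLeft (c • M) = c • traceLeft M := by
    ext e f
    simp [traceLeft, Finset.mul_sum]
  rw [condEntropy, condEntropy, h, entropy_smul hM.1, entropy_smul (posSemidef_traceLeft hM).1,
    trace_traceLeft]
  ring

lemma traceLeft_sum [Fintype a] {K : Type} [Fintype K] (M : K → Op (a × b)) :
    traceLeft (∑ k, M k) = ∑ k, traceLeft (M k) := by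
  ext e f
  simp only [traceLeft, Matrix.of_apply, Matrix.sum_apply]
  exact Finset.sum_comm

lemma quadForm_sum [Fintype a] {K : Type} [Fintype K] (s : ℝ) (M N : K → Op a) (Z : Op a) :
    quadForm s (∑ k, M k) (∑ k, N k) Z = ∑ k, quadForm s (M k) (N k) Z := by
  simp only [quadForm, Matrix.sum_mul, Matrix.trace_sub,
    Matrix.trace_sum, Complex.sub_re, Complex.re_sum, Finset.mul_sum, Finset.sum_sub_distrib,
    mul_sub]

lemma kronecker_sum {K : Type} [Fintype K] (A : Op a) (B : K → Op b) :
    A ⊗ₖ (∑ k, B k) = ∑ k, A ⊗ₖ B k := by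
  ext
  simp [Matrix.sum_apply, Finset.mul_sum]

/-- Concavity of the conditional entropy, in homogeneous form. -/
theorem sum_condEntropy_le_condEntropy_sum [Fintype a] [DecidableEq a] [Fintype b] [DecidableEq b]
    {K : Type} [Fintype K] {M : K → Op (a × b)}
    (hM : ∀ k, (M k).PosSemidef) : ∑ k, condEntropy (M k) ≤ condEntropy (∑ k, M k) := by
  have hS : (∑ k, M k).PosSemidef := Matrix.posSemidef_sum _ fun k _ => hM k
  have h : ∑ _ : Unit, relEntropy (∑ k, M k) ((1 : Op a) ⊗ₖ traceLeft (∑ k, M k)) ≤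
      ∑ k, relEntropy (M k) ((1 : Op a) ⊗ₖ traceLeft (M k)) := by
    refine sum_relEntropy_le_sum_relEntropy (fun _ => hS)
      (fun _ => posSemidef_one_kronecker (posSemidef_traceLeft hS))
      (fun _ => mulVec_eq_zero_of_one_kronecker_traceLeft hS) hM
      (fun k => posSemidef_one_kronecker (posSemidef_traceLeft (hM k)))
      (fun k => mulVec_eq_zero_of_one_kronecker_traceLeft (hM k)) fun s _ Z => ⟨fun _ => Z (), ?_⟩
    rw [Fintype.sum_unique, traceLeft_sum, kronecker_sum, quadForm_sum]
  rw [Fintype.sum_unique] at h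
  simp only [condEntropy_eq_relEntropy (hM _), condEntropy_eq_relEntropy hS]
  rw [← Finset.mul_sum, Finset.sum_add_distrib, ← Finset.mul_sum, Matrix.trace_sum, Complex.re_sum]
  have h2 : 0 < (Real.log 2)⁻¹ := inv_pos.2 (Real.log_pos one_lt_two)
  nlinarith

/-- A Schwarz inequality: with `Y = ∑ l, X l * W l`, the difference of the two sides is
`∑ l, Tr ((X l - Y * (W l)ᴴ)ᴴ * M * (X l - Y * (W l)ᴴ))`. -/
lemma trace_sum_mul_le {L n : Type} {n' : L → Type} [Fintype L] [Fintype n] [DecidableEq n]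
    [∀ l, Fintype (n' l)] {M : Op n} (hM : M.PosSemidef) {W : ∀ l, Matrix (n' l) n ℂ}
    (hW : ∑ l, (W l)ᴴ * W l = 1) (X : ∀ l, Matrix n (n' l) ℂ) :
    ((∑ l, X l * W l)ᴴ * M * (∑ l, X l * W l)).trace.re ≤ ∑ l, ((X l)ᴴ * M * X l).trace.re := by
  set Y := ∑ l, X l * W l with hY
  have h0 : ∀ l, 0 ≤ ((X l - Y * (W l)ᴴ)ᴴ * M * (X l - Y * (W l)ᴴ)).trace.re := fun l =>
    (Complex.le_def.1 (hM.conjTranspose_mul_mul_same _).trace_nonneg).1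
  have h1 : ∀ l, ((X l - Y * (W l)ᴴ)ᴴ * M * (X l - Y * (W l)ᴴ)).trace =
      ((X l)ᴴ * M * X l).trace - (Yᴴ * M * (X l * W l)).trace - ((X l * W l)ᴴ * M * Y).trace +
        (Yᴴ * M * Y * ((W l)ᴴ * W l)).trace := by
    intro l
    have e1 : (Yᴴ * M * (X l * W l)).trace = (W l * Yᴴ * M * X l).trace := by
      rw [← Matrix.mul_assoc, Matrix.trace_mul_comm]
      simp only [Matrix.mul_assoc]
    have e2 : ((X l * W l)ᴴ * M * Y).trace = ((X l)ᴴ * M * (Y * (W l)ᴴ)).trace := by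
      rw [Matrix.conjTranspose_mul, Matrix.mul_assoc, Matrix.mul_assoc, Matrix.trace_mul_comm]
      simp only [Matrix.mul_assoc]
    have e3 : (Yᴴ * M * Y * ((W l)ᴴ * W l)).trace = (W l * Yᴴ * M * (Y * (W l)ᴴ)).trace := by
      rw [← Matrix.mul_assoc, Matrix.trace_mul_comm]
      simp only [Matrix.mul_assoc]
    rw [e1, e2, e3]
    simp only [Matrix.conjTranspose_sub, Matrix.conjTranspose_mul,
      Matrix.conjTranspose_conjTranspose, Matrix.sub_mul, Matrix.mul_sub, Matrix.trace_sub]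
    ring
  have h2 : ∑ l, ((X l - Y * (W l)ᴴ)ᴴ * M * (X l - Y * (W l)ᴴ)).trace =
      ∑ l, ((X l)ᴴ * M * X l).trace - (Yᴴ * M * Y).trace := by
    simp only [h1, Finset.sum_add_distrib, Finset.sum_sub_distrib]
    rw [← Matrix.trace_sum, ← Matrix.trace_sum, ← Matrix.trace_sum,
      ← Matrix.mul_sum, ← Matrix.mul_sum, hW, ← Matrix.sum_mul, ← Matrix.sum_mul,
      ← Matrix.conjTranspose_sum, ← hY, Matrix.mul_one]
    ring
  have h3 := congrArg Complex.re h2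
  rw [Complex.re_sum, Complex.sub_re, Complex.re_sum] at h3
  have := Finset.sum_nonneg fun l (_ : l ∈ Finset.univ) => h0 l
  linarith

/-- Passing from a family `Z l` to `∑ l, (W l)ᴴ * Z l * W l` preserves the linear part of `quadForm`
and, by the Schwarz inequality, does not increase the quadratic part. -/
lemma sum_quadForm_conj_le {L n : Type} {n' : L → Type} [Fintype L] [Fintype n] [DecidableEq n]
    [∀ l, Fintype (n' l)] [∀ l, DecidableEq (n' l)] {M N : Op n} (hM : M.PosSemidef)
    (hN : N.PosSemidef) {W : ∀ l, Matrix (n' l) n ℂ} (hW : ∑ l, (W l)ᴴ * W l = 1) {s : ℝ}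
    (hs : s ∈ Set.Ioo (0 : ℝ) 1) (Z : ∀ l, Op (n' l)) :
    ∑ l, quadForm s (W l * M * (W l)ᴴ) (W l * N * (W l)ᴴ) (Z l) ≤
      quadForm s M N (∑ l, (W l)ᴴ * Z l * W l) := by
  have e0 : (∑ l, (W l)ᴴ * Z l * W l)ᴴ = ∑ l, (W l)ᴴ * (Z l)ᴴ * W l := by
    simp [Matrix.conjTranspose_sum, Matrix.conjTranspose_mul, Matrix.mul_assoc]
  have h1 := trace_sum_mul_le hM hW fun l => (W l)ᴴ * Z l
  have h2 := trace_sum_mul_le hN hW fun l => (W l)ᴴ * (Z l)ᴴ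
  rw [← e0, Matrix.conjTranspose_conjTranspose] at h2
  have e1 : ((∑ l, (W l)ᴴ * Z l * W l)ᴴ * (M - N)).trace =
      ∑ l, ((Z l)ᴴ * (W l * M * (W l)ᴴ - W l * N * (W l)ᴴ)).trace := by
    rw [e0, Matrix.sum_mul, Matrix.trace_sum]
    refine Finset.sum_congr rfl fun l _ => ?_
    rw [← Matrix.sub_mul, ← Matrix.mul_sub, Matrix.mul_assoc, Matrix.mul_assoc,
      Matrix.trace_mul_comm]
    simp only [Matrix.mul_assoc]
  simp only [quadForm, Finset.sum_sub_distrib, ← Finset.mul_sum]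
  rw [e1, Complex.re_sum]
  have e2 : ∀ l, ((W l)ᴴ * Z l)ᴴ * M * ((W l)ᴴ * Z l) = (Z l)ᴴ * (W l * M * (W l)ᴴ) * Z l := by
    intro l
    simp [Matrix.conjTranspose_mul, Matrix.mul_assoc]
  have e3 : ∀ l, ((W l)ᴴ * (Z l)ᴴ)ᴴ * N * ((W l)ᴴ * (Z l)ᴴ) =
      Z l * (W l * N * (W l)ᴴ) * (Z l)ᴴ := by
    intro l
    simp [Matrix.conjTranspose_mul, Matrix.mul_assoc]
  simp only [e2] at h1
  simp only [e3] at h2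
  have h1' := mul_le_mul_of_nonneg_left h1 hs.1.le
  have h2' := mul_le_mul_of_nonneg_left h2 (sub_nonneg.2 hs.2.le)
  linarith

lemma traceLeft_conj_one_kronecker [Fintype a] [DecidableEq a] [Fintype b] {b' : Type} (V :
    Matrix b' b ℂ)
    (M : Op (a × b)) :
    traceLeft (((1 : Op a) ⊗ₖ V) * M * ((1 : Op a) ⊗ₖ V)ᴴ) = V * traceLeft M * Vᴴ := by
  ext x y
  simp only [traceLeft, Matrix.of_apply, Matrix.mul_apply, Matrix.kroneckerMap_apply,
    Matrix.conjTranspose_apply, Fintype.sum_prod_type, Matrix.one_apply, ite_mul, one_mul, zero_mul,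
    apply_ite star, star_zero, mul_ite, mul_zero, Finset.sum_mul, Finset.mul_sum,
    Finset.sum_ite_irrel, Finset.sum_const_zero, Finset.sum_ite_eq, Finset.mem_univ, if_true]
  rw [Finset.sum_comm]
  refine Finset.sum_congr rfl fun e _ => Finset.sum_comm

/-- Data processing for the conditional entropy: a measurement with Kraus operators `V l` on the
conditioning system does not decrease it on average. -/
theorem condEntropy_le_sum_condEntropy_conj [Fintype a] [DecidableEq a] [Fintype b]
    [DecidableEq b] {L : Type} [Fintype L] {b' : L → Type} [∀ l, Fintype (b' l)]
    [∀ l, DecidableEq (b' l)] {M : Op (a × b)} (hM : M.PosSemidef)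
    {V : ∀ l, Matrix (b' l) b ℂ} (hV : ∑ l, (V l)ᴴ * V l = 1) :
    condEntropy M ≤
      ∑ l, condEntropy (((1 : Op a) ⊗ₖ V l) * M * ((1 : Op a) ⊗ₖ V l)ᴴ) := by
  have hM' : ∀ l, (((1 : Op a) ⊗ₖ V l) * M * ((1 : Op a) ⊗ₖ V l)ᴴ).PosSemidef := fun l =>
    hM.mul_mul_conjTranspose_same _
  have hW : ∑ l, ((1 : Op a) ⊗ₖ V l)ᴴ * ((1 : Op a) ⊗ₖ V l) = 1 := by
    simp only [Matrix.conjTranspose_kronecker, ← Matrix.mul_kronecker_mul,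
      Matrix.conjTranspose_one, Matrix.one_mul]
    rw [← kronecker_sum, hV, Matrix.one_kronecker_one]
  have h : ∑ l, relEntropy (((1 : Op a) ⊗ₖ V l) * M * ((1 : Op a) ⊗ₖ V l)ᴴ)
        ((1 : Op a) ⊗ₖ traceLeft (((1 : Op a) ⊗ₖ V l) * M * ((1 : Op a) ⊗ₖ V l)ᴴ)) ≤
      ∑ _ : Unit, relEntropy M ((1 : Op a) ⊗ₖ traceLeft M) := by
    refine sum_relEntropy_le_sum_relEntropy hM'
      (fun l => posSemidef_one_kronecker (posSemidef_traceLeft (hM' l)))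
      (fun l => mulVec_eq_zero_of_one_kronecker_traceLeft (hM' l)) (fun _ => hM)
      (fun _ => posSemidef_one_kronecker (posSemidef_traceLeft hM))
      (fun _ => mulVec_eq_zero_of_one_kronecker_traceLeft hM) fun s hs Z =>
        ⟨fun _ => ∑ l, ((1 : Op a) ⊗ₖ V l)ᴴ * Z l * ((1 : Op a) ⊗ₖ V l), ?_⟩
    have e : ∀ l, (1 : Op a) ⊗ₖ traceLeft (((1 : Op a) ⊗ₖ V l) * M * ((1 : Op a) ⊗ₖ V l)ᴴ) =
        ((1 : Op a) ⊗ₖ V l) * ((1 : Op a) ⊗ₖ traceLeft M) * ((1 : Op a) ⊗ₖ V l)ᴴ := by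
      intro l
      rw [traceLeft_conj_one_kronecker, Matrix.conjTranspose_kronecker, ← Matrix.mul_kronecker_mul,
        ← Matrix.mul_kronecker_mul, Matrix.conjTranspose_one, Matrix.one_mul, Matrix.one_mul]
    simp only [e]
    rw [Fintype.sum_unique (fun _ : Unit => quadForm _ _ _ _)]
    exact sum_quadForm_conj_le hM (posSemidef_one_kronecker (posSemidef_traceLeft hM)) hW hs Z
  rw [Fintype.sum_unique (fun _ : Unit => relEntropy _ _)] at h
  have ht : ∑ l, (((1 : Op a) ⊗ₖ V l) * M * ((1 : Op a) ⊗ₖ V l)ᴴ).trace = M.trace := by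
    simp only [Matrix.mul_assoc, Matrix.trace_mul_comm ((1 : Op a) ⊗ₖ V _)]
    rw [← Matrix.trace_sum, ← Matrix.mul_sum, hW, Matrix.mul_one]
  have ht' := congrArg Complex.re ht
  rw [Complex.re_sum] at ht'
  simp only [condEntropy_eq_relEntropy (hM' _), condEntropy_eq_relEntropy hM]
  rw [← Finset.mul_sum, Finset.sum_add_distrib, ← Finset.mul_sum, ht']
  have h2 : 0 < (Real.log 2)⁻¹ := inv_pos.2 (Real.log_pos one_lt_two)
  nlinarith

end

section

/-! ### Kraus operators -/

open scoped MatrixOrder in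
/-- Kraus decomposition of a completely positive map, read off from a factorisation `Bᴴ * B` of its
Choi matrix. -/
theorem exists_kraus {n : ℕ} {b : Type} [Fintype b] {Φ : Op (Fin n) →ₗ[ℂ] Op b}
    (hΦ : IsCompletelyPositive Φ) :
    ∃ V : b × Fin n → Matrix b (Fin n) ℂ, ∀ M, Φ M = ∑ l, V l * M * (V l)ᴴ := by
  classical
  -- the unnormalised maximally entangled vector, from which `Φ ⊗ id` makes the Choi matrix
  set w : Fin n × Fin n → ℂ := fun p => if p.1 = p.2 then 1 else 0 with hw
  have hC := hΦ n _ (Matrix.posSemidef_vecMulVec_self_star w)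
  obtain ⟨B, hB⟩ := CStarAlgebra.nonneg_iff_eq_star_mul_self.1 hC.nonneg
  rw [Matrix.star_eq_conjTranspose] at hB
  refine ⟨fun l => Matrix.of fun p u => star (B l (p, u)), fun M => ?_⟩
  have hentry : ∀ p q u v, Φ (Matrix.single u v 1) p q =
      ∑ l, star (B l (p, u)) * B l (q, v) := by
    intro p q u v
    have := congrFun (congrFun hB (p, u)) (q, v)
    rw [Matrix.mul_apply] at this
    simp only [Matrix.conjTranspose_apply] at this
    rw [← this, ampliation, Matrix.of_apply]
    refine congrArg (fun N => Φ N p q) ?_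
    ext x y
    simp [Matrix.single_apply, Matrix.vecMulVec_apply, hw, ← ite_and, eq_comm, and_comm]
  ext p q
  have hM : M = ∑ u, ∑ v, M u v • Matrix.single u v (1 : ℂ) := by
    conv_lhs => rw [Matrix.matrix_eq_sum_single M]
    simp
  conv_lhs => rw [hM]
  simp only [map_sum, map_smul, Matrix.sum_apply, Matrix.smul_apply, hentry, smul_eq_mul,
    Matrix.mul_apply, Matrix.of_apply, Matrix.conjTranspose_apply, star_star, Finset.mul_sum,
    Finset.sum_mul]
  rw [Finset.sum_comm]
  simp_rw [Finset.sum_comm (s := (Finset.univ : Finset (Fin n)))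
    (t := (Finset.univ : Finset (b × Fin n)))]
  refine Finset.sum_congr rfl fun l _ => Finset.sum_congr rfl fun v _ =>
    Finset.sum_congr rfl fun u _ => ?_
  ring

lemma sum_conjTranspose_mul_self_eq_one {L a b : Type} [Fintype L] [Fintype a] [DecidableEq a]
    [Fintype b] {V : L → Matrix b a ℂ}
    (hV : ∀ M : Op a, (∑ l, V l * M * (V l)ᴴ).trace = M.trace) : ∑ l, (V l)ᴴ * V l = 1 := by
  refine Matrix.ext_iff_trace_mul_left.2 fun M => ?_
  rw [Matrix.mul_one, ← hV M, Matrix.mul_sum, Matrix.trace_sum, Matrix.trace_sum]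
  refine Finset.sum_congr rfl fun l _ => ?_
  rw [← Matrix.mul_assoc, Matrix.trace_mul_comm, ← Matrix.mul_assoc]

/-- The trace, as an instrument with a single outcome that replaces a system by a trivial one. The
output dimension is a variable so that it can be the `i`-th entry of an updated tuple. -/
lemma exists_isInstrument_trace (n : ℕ) {n' : ℕ} (h : n' = 1) :
    ∃ Φ : Unit → (Op (Fin n) →ₗ[ℂ] Op (Fin n')), IsInstrument Φ := by
  subst h
  let T : Op (Fin n) →ₗ[ℂ] Op (Fin 1) :=
    { toFun := fun M => Matrix.of fun _ _ => M.trace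
      map_add' := fun M N => by ext; simp
      map_smul' := fun c M => by ext; simp }
  refine ⟨fun _ => T, fun _ k M hM => ?_, fun M => by simp [T, Matrix.trace]⟩
  exact (posSemidef_traceLeft hM).submatrix Prod.snd

/-! ### Splitting off one party -/

variable {m : ℕ} {d d' : Fin m → ℕ}

/-- Joint indices of all systems but `Xᵢ`. -/
abbrev Rest (d : Fin m → ℕ) (i : Fin m) : Type := ∀ j : {j : Fin m // j ≠ i}, Fin (d j)

/-- Joint indices of `X₁⋯Xₘ`, split into the entries away from `i` and the `i`-th entry. The
dimensions `d'` agree with `d` away from `i`, and the other entries are labelled by `d`, so that the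
splittings of `Sys d` and of `Sys d'` share the factor `Rest d i`. -/
def splitEquiv (i : Fin m) (h : ∀ j, j ≠ i → d' j = d j) : Sys d' ≃ Rest d i × Fin (d' i) where
  toFun a := (fun j => Fin.cast (h j j.2) (a j), a i)
  invFun p := fun j => if hj : j = i then Fin.cast (congrArg d' hj.symm) p.2
    else Fin.cast (h j hj).symm (p.1 ⟨j, hj⟩)
  left_inv a := by
    funext j
    by_cases hj : j = i
    · subst hj
      simp
    · simp [hj]
  right_inv p := by
    ext j
    · simp [j.2]
    · simp

@[simp] lemma splitEquiv_symm_self (i : Fin m) (h : ∀ j, j ≠ i → d' j = d j)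
    (p : Rest d i × Fin (d' i)) : (splitEquiv i h).symm p i = p.2 := by
  simp [splitEquiv]

lemma splitEquiv_symm_of_ne (i : Fin m) (h : ∀ j, j ≠ i → d' j = d j)
    (p : Rest d i × Fin (d' i)) {j : Fin m} (hj : j ≠ i) :
    (splitEquiv i h).symm p j = Fin.cast (h j hj).symm (p.1 ⟨j, hj⟩) := by
  simp [splitEquiv, hj]

lemma replaceAt_splitEquiv_symm (i : Fin m) (h : ∀ j, j ≠ i → d' j = d j)
    (x : Fin (d i)) (p : Rest d i × Fin (d' i)) :
    replaceAt i h x ((splitEquiv i h).symm p) =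
      (splitEquiv (d := d) i fun _ _ => rfl).symm (p.1, x) := by
  funext j
  by_cases hj : j = i
  · subst hj
    simp [replaceAt]
  · simp [replaceAt, splitEquiv_symm_of_ne, hj]

lemma update_splitEquiv_symm_self (i : Fin m) (r : Rest d i) (x y : Fin (d i)) :
    Function.update ((splitEquiv (d := d) i fun _ _ => rfl).symm (r, x)) i y =
      (splitEquiv (d := d) i fun _ _ => rfl).symm (r, y) := by
  funext j
  by_cases hj : j = i
  · subst hj
    simp
  · simp [splitEquiv_symm_of_ne, hj]

lemma update_splitEquiv_symm_of_ne (i : Fin m) (h : ∀ j, j ≠ i → d' j = d j) (r : Rest d i)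
    (x : Fin (d' i)) {j : Fin m} (hj : j ≠ i) (y : Fin (d' j)) :
    Function.update ((splitEquiv i h).symm (r, x)) j y =
      (splitEquiv i h).symm (Function.update r ⟨j, hj⟩ (Fin.cast (h j hj) y), x) := by
  funext k
  by_cases hk : k = i
  · subst hk
    rw [Function.update_of_ne (Ne.symm hj)]
    simp
  · by_cases hkj : k = j
    · subst hkj
      simp [splitEquiv_symm_of_ne, hk]
    · rw [Function.update_of_ne hkj, splitEquiv_symm_of_ne _ _ _ hk, splitEquiv_symm_of_ne _ _ _ hk]
      exact congrArg _ (Function.update_of_ne (fun e => hkj (congrArg Subtype.val e)) _ _).symm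

variable {E : Type}

/-- `X₁⋯XₘE` split into the systems other than `Xᵢ` and the pair `XᵢE`. -/
def splitEquivProd (i : Fin m) (h : ∀ j, j ≠ i → d' j = d j) (E : Type) :
    Sys d' × E ≃ Rest d i × (Fin (d' i) × E) :=
  ((splitEquiv i h).prodCongr (Equiv.refl E)).trans (Equiv.prodAssoc _ _ _)

/-- An operator on `X₁⋯XₘE`, seen as one on the systems other than `Xᵢ` and the pair `XᵢE`. -/
def splitOp (i : Fin m) (h : ∀ j, j ≠ i → d' j = d j) (σ : Op (Sys d' × E)) :
    Op (Rest d i × (Fin (d' i) × E)) :=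
  σ.submatrix (splitEquivProd i h E).symm (splitEquivProd i h E).symm

lemma marginal_eq_traceLeft_splitOp (i : Fin m) (σ : Op (Sys d × E)) :
    marginal i σ = traceLeft (splitOp i (fun _ _ => rfl) σ) := by
  ext p q
  simp only [marginal, traceLeft, Matrix.of_apply, splitOp, Matrix.submatrix_apply]
  rw [← (splitEquiv (d := d) i fun _ _ => rfl).symm.sum_comp, Fintype.sum_prod_type]
  refine Finset.sum_congr rfl fun r _ => ?_
  simp only [splitEquiv_symm_self, update_splitEquiv_symm_self, Finset.sum_ite_eq',
    Finset.mem_univ, if_true]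
  rfl

lemma traceLeft_marginal (i : Fin m) (σ : Op (Sys d × E)) :
    traceLeft (marginal i σ) = traceLeft σ := by
  ext e f
  rw [marginal_eq_traceLeft_splitOp]
  simp only [traceLeft, Matrix.of_apply, splitOp, Matrix.submatrix_apply]
  rw [← (splitEquiv (d := d) i fun _ _ => rfl).symm.sum_comp, Fintype.sum_prod_type,
    Finset.sum_comm]
  rfl

/-- The map `Φ` applied to the system `Xᵢ` of an operator on `X₁⋯XₘE`. -/
def applyAtProd (i : Fin m) (h : ∀ j, j ≠ i → d' j = d j)
    (Φ : Op (Fin (d i)) →ₗ[ℂ] Op (Fin (d' i))) (σ : Op (Sys d × E)) : Op (Sys d' × E) :=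
  Matrix.of fun p q =>
    Φ (Matrix.of fun x y => σ (replaceAt i h x p.1, p.2) (replaceAt i h y q.1, q.2)) (p.1 i) (q.1 i)

lemma traceRight_applyAtProd [Fintype E] (i : Fin m) (h : ∀ j, j ≠ i → d' j = d j)
    (Φ : Op (Fin (d i)) →ₗ[ℂ] Op (Fin (d' i))) (σ : Op (Sys d × E)) :
    traceRight (applyAtProd i h Φ σ) = applyAt i h Φ (traceRight σ) := by
  ext a b
  simp only [traceRight, applyAtProd, applyAt, Matrix.of_apply]
  rw [← Matrix.sum_apply, ← map_sum]
  refine congrArg (fun M => Φ M (a i) (b i)) ?_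
  ext x y
  simp [Matrix.sum_apply]

/-- A completely positive map on `Xᵢ`, tensored with the identity on the other systems and on `E`,
has Kraus operators `1 ⊗ V l ⊗ 1` with respect to the splitting. -/
lemma splitOp_applyAtProd [Fintype E] [DecidableEq E] (i : Fin m) (h : ∀ j, j ≠ i → d' j = d j)
    {Φ : Op (Fin (d i)) →ₗ[ℂ] Op (Fin (d' i))} {L : Type} [Fintype L]
    {V : L → Matrix (Fin (d' i)) (Fin (d i)) ℂ} (hV : ∀ M, Φ M = ∑ l, V l * M * (V l)ᴴ)
    (σ : Op (Sys d × E)) :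
    splitOp i h (applyAtProd i h Φ σ) =
      ∑ l, ((1 : Op (Rest d i)) ⊗ₖ (V l ⊗ₖ (1 : Op E))) * splitOp i (fun _ _ => rfl) σ *
        ((1 : Op (Rest d i)) ⊗ₖ (V l ⊗ₖ (1 : Op E)))ᴴ := by
  ext ⟨r, x, e⟩ ⟨r', y, f⟩
  have h1 : ∀ r x e, (splitEquivProd i h E).symm (r, x, e) = ((splitEquiv i h).symm (r, x), e) :=
    fun _ _ _ => rfl
  simp only [splitOp, Matrix.submatrix_apply, applyAtProd, Matrix.of_apply, h1,
    splitEquiv_symm_self, replaceAt_splitEquiv_symm, hV, Matrix.sum_apply]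
  refine Finset.sum_congr rfl fun l _ => ?_
  simp only [Matrix.mul_apply, Matrix.of_apply, Matrix.conjTranspose_apply,
    Matrix.kroneckerMap_apply, Fintype.sum_prod_type, Matrix.one_apply, Matrix.submatrix_apply,
    ite_mul, one_mul, zero_mul, mul_ite, mul_one, mul_zero, apply_ite star, star_zero,
    Finset.sum_ite_irrel, Finset.sum_const_zero, Finset.sum_ite_eq, Finset.mem_univ, if_true]
  rfl

/-- No signalling: an instrument on `Xᵢ` leaves the total marginal on `XⱼE`, `j ≠ i`, unchanged, up
to the identification of `Fin (d' j)` with `Fin (d j)`. -/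
lemma sum_marginal_applyAtProd {K : Type} [Fintype K] (i : Fin m) (h : ∀ j, j ≠ i → d' j = d j)
    {Φ : K → (Op (Fin (d i)) →ₗ[ℂ] Op (Fin (d' i)))} (hΦ : IsInstrument Φ) {j : Fin m}
    (hj : j ≠ i) (σ : Op (Sys d × E)) :
    ∑ k, marginal j (applyAtProd i h (Φ k) σ) =
      (marginal j σ).submatrix ((finCongr (h j hj)).prodCongr (Equiv.refl E))
        ((finCongr (h j hj)).prodCongr (Equiv.refl E)) := by
  ext ⟨x, e⟩ ⟨y, f⟩
  simp only [marginal, Matrix.sum_apply, Matrix.of_apply, Matrix.submatrix_apply, applyAtProd,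
    Equiv.prodCongr_apply, Prod.map, finCongr_apply, Equiv.refl_apply]
  rw [Finset.sum_comm, ← (splitEquiv i h).symm.sum_comp,
    ← (splitEquiv (d := d) i fun _ _ => rfl).symm.sum_comp, Fintype.sum_prod_type,
    Fintype.sum_prod_type]
  refine Finset.sum_congr rfl fun r _ => ?_
  simp only [update_splitEquiv_symm_of_ne _ _ _ _ hj, splitEquiv_symm_self,
    replaceAt_splitEquiv_symm, splitEquiv_symm_of_ne _ _ _ hj, Fin.cast_eq_self]
  have hc : (Fin.cast (h j hj).symm (r ⟨j, hj⟩) = x) = (r ⟨j, hj⟩ = Fin.cast (h j hj) x) := by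
    rw [Fin.ext_iff, Fin.ext_iff]
    rfl
  simp only [hc]
  by_cases hr : r ⟨j, hj⟩ = Fin.cast (h j hj) x
  · simp only [hr, if_true]
    have := hΦ.tracePreserving (Matrix.of fun u v =>
      σ ((splitEquiv (d := d) i fun _ _ => rfl).symm (r, u), e)
        ((splitEquiv (d := d) i fun _ _ => rfl).symm
          (Function.update r ⟨j, hj⟩ (Fin.cast (h j hj) y), v), f))
    simpa [Matrix.trace, Matrix.sum_apply] using this
  · simp [hr]

end

section

/-! ### Conditional multiparty information -/

lemma condEntropy_submatrix_equiv {a b a' b' : Type} [Fintype a] [DecidableEq a] [Fintype b]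
    [DecidableEq b] [Fintype a'] [DecidableEq a'] [Fintype b'] [DecidableEq b'] (e : a' ≃ a)
    (f : b' ≃ b) {M : Op (a × b)} (hM : M.PosSemidef) :
    condEntropy (M.submatrix (e.prodCongr f) (e.prodCongr f)) = condEntropy M := by
  have h : traceLeft (M.submatrix (e.prodCongr f) (e.prodCongr f)) =
      (traceLeft M).submatrix f f := by
    ext x y
    exact Fintype.sum_equiv e _ _ fun _ => rfl
  rw [condEntropy, condEntropy, h, entropy_submatrix_equiv _ hM.1,
    entropy_submatrix_equiv _ (posSemidef_traceLeft hM).1]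

lemma condEntropy_eq_zero_of_unique {a b : Type} [Fintype a] [DecidableEq a] [Unique a] [Fintype b]
    [DecidableEq b] {M : Op (a × b)} (hM : M.PosSemidef) : condEntropy M = 0 := by
  have h : traceLeft M =
      M.submatrix (Equiv.uniqueProd b a).symm (Equiv.uniqueProd b a).symm := by
    ext x y
    simp [traceLeft, Equiv.uniqueProd]
  rw [condEntropy, h, entropy_submatrix_equiv _ hM.1, sub_self]

variable {m : ℕ} {d d' : Fin m → ℕ} {E : Type}

lemma splitOp_submatrix (i : Fin m) (h : ∀ j, j ≠ i → d' j = d j) (σ : Op (Sys d' × E)) :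
    (splitOp i h σ).submatrix (splitEquivProd i h E) (splitEquivProd i h E) = σ := by
  ext p q
  simp [splitOp]

lemma posSemidef_splitOp_iff {i : Fin m} {h : ∀ j, j ≠ i → d' j = d j} {σ : Op (Sys d' × E)} :
    (splitOp i h σ).PosSemidef ↔ σ.PosSemidef :=
  ⟨fun hσ => splitOp_submatrix i h σ ▸ hσ.submatrix _, fun hσ => hσ.submatrix _⟩

lemma posSemidef_marginal (i : Fin m) {σ : Op (Sys d × E)} (hσ : σ.PosSemidef) :
    (marginal i σ).PosSemidef := by
  rw [marginal_eq_traceLeft_splitOp]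
  exact posSemidef_traceLeft (posSemidef_splitOp_iff.2 hσ)

variable [Fintype E] [DecidableEq E]

/-- The conditional multiparty information as a sum of entropies of parties `j ≠ i` conditioned
on `E`, minus the entropy of all of them together conditioned on `XᵢE`. -/
lemma condMultiInfo_eq (i : Fin m) (h : ∀ j, j ≠ i → d' j = d j) {σ : Op (Sys d' × E)}
    (hσ : σ.PosSemidef) :
    condMultiInfo σ = ∑ j ∈ Finset.univ.erase i, condEntropy (marginal j σ) -
      condEntropy (splitOp i h σ) := by
  have h1 : traceLeft (splitOp i h σ) = marginal i σ := by
    rw [marginal_eq_traceLeft_splitOp]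
    ext ⟨x, e⟩ ⟨y, f⟩
    simp only [traceLeft, Matrix.of_apply, splitOp, Matrix.submatrix_apply]
    let g : Rest d i ≃ Rest d' i :=
      Equiv.piCongrRight fun j => finCongr (h j j.2).symm
    refine Fintype.sum_equiv g _ _ fun r => ?_
    have hg : ∀ (z : Fin (d' i)) (w : E), (splitEquivProd i h E).symm (r, z, w) =
        (splitEquivProd (d := d') i (fun _ _ => rfl) E).symm (g r, z, w) := by
      intro z w
      refine Prod.ext (funext fun j => ?_) rfl
      change (splitEquiv i h).symm (r, z) j =
        (splitEquiv (d := d') i fun _ _ => rfl).symm (g r, z) j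
      by_cases hj : j = i
      · subst hj
        simp
      · rw [splitEquiv_symm_of_ne _ _ _ hj, splitEquiv_symm_of_ne _ _ _ hj]
        rfl
    rw [hg, hg]
  have h2 : condEntropy (splitOp i h σ) = entropy σ - entropy (marginal i σ) := by
    rw [condEntropy, h1, splitOp, entropy_submatrix_equiv _ hσ.1]
  rw [condMultiInfo, ← Finset.sum_erase_add _ _ (Finset.mem_univ i), h2, condEntropy, condEntropy,
    traceLeft_marginal]
  ring

lemma condMultiInfo_smul {σ : Op (Sys d × E)} (hσ : σ.PosSemidef) (c : ℝ) :
    condMultiInfo (c • σ) = c * condMultiInfo σ := by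
  have h : ∀ i, marginal i (c • σ) = c • marginal i σ := by
    intro i
    ext p q
    simp [marginal, Finset.mul_sum]
  rw [condMultiInfo, condMultiInfo, condEntropy_smul hσ, mul_sub, Finset.mul_sum]
  simp only [h, condEntropy_smul (posSemidef_marginal _ hσ)]

lemma sum_conjTranspose_mul_kronecker_one {L a : Type} [Fintype L] [Fintype a]
    [DecidableEq a] {b : L → Type} [∀ l, Fintype (b l)] {V : ∀ l, Matrix (b l) a ℂ}
    (hV : ∑ l, (V l)ᴴ * V l = 1) (E : Type) [Fintype E] [DecidableEq E] :
    ∑ l, (V l ⊗ₖ (1 : Op E))ᴴ * (V l ⊗ₖ (1 : Op E)) = 1 := by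
  have : ∀ l, (V l ⊗ₖ (1 : Op E))ᴴ * (V l ⊗ₖ (1 : Op E)) = ((V l)ᴴ * V l) ⊗ₖ (1 : Op E) := by
    intro l
    rw [Matrix.conjTranspose_kronecker, ← Matrix.mul_kronecker_mul, Matrix.conjTranspose_one,
      Matrix.one_mul]
  simp only [this]
  rw [← Matrix.one_kronecker_one, ← hV]
  ext p q
  simp [Matrix.sum_apply, Finset.sum_mul]

/-- A unilocal instrument does not increase the conditional multiparty information on average. The
terms conditioned on `E` alone are controlled by concavity, the one conditioned on `XᵢE` by data
processing. -/
theorem sum_condMultiInfo_applyAtProd_le {K : Type} [Fintype K] (i : Fin m)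
    (h : ∀ j, j ≠ i → d' j = d j) {Φ : K → (Op (Fin (d i)) →ₗ[ℂ] Op (Fin (d' i)))}
    (hΦ : IsInstrument Φ) {σ : Op (Sys d × E)} (hσ : σ.PosSemidef) :
    (∀ k, (applyAtProd i h (Φ k) σ).PosSemidef) ∧
      ∑ k, condMultiInfo (applyAtProd i h (Φ k) σ) ≤ condMultiInfo σ := by
  choose V hV using fun k => exists_kraus (hΦ.completelyPositive k)
  have hs := posSemidef_splitOp_iff (h := fun _ _ => rfl) (i := i).2 hσ
  have hterm : ∀ k l, (((1 : Op (Rest d i)) ⊗ₖ (V k l ⊗ₖ (1 : Op E))) *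
      splitOp i (fun _ _ => rfl) σ *
        ((1 : Op (Rest d i)) ⊗ₖ (V k l ⊗ₖ (1 : Op E)))ᴴ).PosSemidef :=
    fun k l => hs.mul_mul_conjTranspose_same _
  have hpos : ∀ k, (applyAtProd i h (Φ k) σ).PosSemidef := by
    intro k
    rw [← posSemidef_splitOp_iff (i := i) (h := h), splitOp_applyAtProd i h (hV k)]
    exact Matrix.posSemidef_sum _ fun l _ => hterm k l
  refine ⟨hpos, ?_⟩
  have hone : ∑ p : (_ : K) × (Fin (d' i) × Fin (d i)), (V p.1 p.2)ᴴ * V p.1 p.2 = 1 := by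
    refine sum_conjTranspose_mul_self_eq_one fun M => ?_
    rw [Fintype.sum_sigma, ← hΦ.tracePreserving M]
    simp only [hV]
  have h1 : condEntropy (splitOp i (fun _ _ => rfl) σ) ≤
      ∑ k, condEntropy (splitOp i h (applyAtProd i h (Φ k) σ)) := by
    refine (condEntropy_le_sum_condEntropy_conj hs
      (sum_conjTranspose_mul_kronecker_one hone E)).trans ?_
    rw [Fintype.sum_sigma]
    refine Finset.sum_le_sum fun k _ => ?_
    rw [splitOp_applyAtProd i h (hV k)]
    exact sum_condEntropy_le_condEntropy_sum (hterm k)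
  have h2 : ∀ j ∈ Finset.univ.erase i,
      ∑ k, condEntropy (marginal j (applyAtProd i h (Φ k) σ)) ≤ condEntropy (marginal j σ) := by
    intro j hj
    have hm : ∀ k, (marginal j (applyAtProd i h (Φ k) σ)).PosSemidef :=
      fun k => posSemidef_marginal j (hpos k)
    have hle := sum_condEntropy_le_condEntropy_sum hm
    rw [sum_marginal_applyAtProd i h hΦ (Finset.ne_of_mem_erase hj)] at hle
    exact hle.trans_eq (condEntropy_submatrix_equiv _ _ (posSemidef_marginal j hσ))
  simp only [condMultiInfo_eq i h (hpos _), condMultiInfo_eq i (fun _ _ => rfl) hσ,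
    Finset.sum_sub_distrib]
  rw [Finset.sum_comm]
  exact sub_le_sub (Finset.sum_le_sum h2) h1

/-- Discarding the parties one after the other does not increase the conditional multiparty
information, which vanishes once all parties are trivial. -/
theorem condMultiInfo_nonneg {σ : Op (Sys d × E)} (hσ : σ.PosSemidef) : 0 ≤ condMultiInfo σ := by
  induction hn : (Finset.univ.filter fun j => d j ≠ 1).card generalizing d with
  | zero =>
    have hd : ∀ j, d j = 1 := by
      intro j
      by_contra hj
      exact absurd (Finset.card_eq_zero.1 hn)
        (Finset.ne_empty_of_mem (Finset.mem_filter.2 ⟨Finset.mem_univ j, hj⟩))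
    obtain rfl : d = fun _ => 1 := funext hd
    rw [condMultiInfo, condEntropy_eq_zero_of_unique hσ, sub_zero]
    exact Finset.sum_nonneg fun j _ =>
      (condEntropy_eq_zero_of_unique (posSemidef_marginal j hσ)).ge
  | succ n ih =>
    obtain ⟨i, hi⟩ := Finset.card_pos.1 (n.succ_pos.trans_eq hn.symm)
    obtain ⟨Φ, hΦ⟩ := exists_isInstrument_trace (d i) (Function.update_self i 1 d)
    obtain ⟨hpos, hle⟩ := sum_condMultiInfo_applyAtProd_le (d' := Function.update d i 1) i
      (fun j hj => Function.update_of_ne hj _ _) hΦ hσ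
    refine le_trans ?_ hle
    rw [Fintype.sum_unique]
    refine ih (hpos _) ?_
    have : (Finset.univ.filter fun j => Function.update d i 1 j ≠ 1) =
        (Finset.univ.filter fun j => d j ≠ 1).erase i := by
      ext j
      by_cases hj : j = i
      · subst hj
        simp
      · simp [hj]
    rw [this, Finset.card_erase_of_mem hi, hn, Nat.add_sub_cancel]

/-! ### Flagged extensions -/

lemma marginal_conj_one_kronecker {E F : Type} [Fintype E]
    (V : Matrix F E ℂ) (i : Fin m) (σ : Op (Sys d × E)) :
    marginal i (((1 : Op (Sys d)) ⊗ₖ V) * σ * ((1 : Op (Sys d)) ⊗ₖ V)ᴴ) =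
      ((1 : Op (Fin (d i))) ⊗ₖ V) * marginal i σ * ((1 : Op (Fin (d i))) ⊗ₖ V)ᴴ := by
  ext ⟨x, e⟩ ⟨y, f⟩
  simp only [marginal, Matrix.of_apply, Matrix.mul_apply, Matrix.kroneckerMap_apply,
    Matrix.conjTranspose_apply, Fintype.sum_prod_type, Matrix.one_apply, ite_mul, one_mul, zero_mul,
    apply_ite star, star_zero, mul_ite, mul_zero, Finset.sum_mul, Finset.mul_sum,
    Finset.sum_ite_irrel, Finset.sum_const_zero, Finset.sum_ite_eq, Finset.mem_univ, if_true]
  rw [← Finset.sum_filter, Finset.sum_comm]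
  refine Finset.sum_congr rfl fun g _ => ?_
  rw [Finset.sum_eq_single x (fun z _ hz => by simp [hz.symm]) (by simp), Finset.sum_comm]
  refine Finset.sum_congr rfl fun g' _ => ?_
  simp only [if_true]
  rw [Finset.sum_filter]

lemma traceRight_conj_one_kronecker {E F : Type} [Fintype E] [DecidableEq E] [Fintype F]
    {V : Matrix F E ℂ} (hV : Vᴴ * V = 1) (σ : Op (Sys d × E)) :
    traceRight (((1 : Op (Sys d)) ⊗ₖ V) * σ * ((1 : Op (Sys d)) ⊗ₖ V)ᴴ) = traceRight σ := by
  ext a b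
  have h : ∀ g g', ∑ x, star (V x g) * V x g' = (1 : Op E) g g' := by
    intro g g'
    rw [← hV]
    rfl
  simp only [traceRight, Matrix.of_apply, Matrix.mul_apply, Matrix.kroneckerMap_apply,
    Matrix.conjTranspose_apply, Fintype.sum_prod_type, Matrix.one_apply, ite_mul, one_mul, zero_mul,
    apply_ite star, star_zero, mul_ite, mul_zero, Finset.sum_mul,
    Finset.sum_ite_irrel, Finset.sum_const_zero, Finset.sum_ite_eq, Finset.mem_univ, if_true]
  rw [Finset.sum_comm]
  refine Finset.sum_congr rfl fun g _ => ?_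
  rw [Finset.sum_comm]
  calc _ = ∑ g', σ (a, g') (b, g) * ∑ x, star (V x g) * V x g' :=
        Finset.sum_congr rfl fun g' _ => by
          rw [Finset.mul_sum]
          exact Finset.sum_congr rfl fun x _ => by ring
    _ = _ := by
      simp only [h]
      simp [Matrix.one_apply]

/-- Extensions of finitely many operators can be combined to one of their sum, with the index as a
flag in the extending system, without increasing the total conditional multiparty information. -/
theorem exists_flagged_extension {K : Type} [Fintype K] {F : K → Type}
    [∀ k, Fintype (F k)] [∀ k, DecidableEq (F k)] {σ : ∀ k, Op (Sys d × F k)}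
    (hσ : ∀ k, (σ k).PosSemidef) :
    ∃ (G : Type) (_ : Fintype G) (_ : DecidableEq G) (τ : Op (Sys d × G)),
      τ.PosSemidef ∧ traceRight τ = ∑ k, traceRight (σ k) ∧
        condMultiInfo τ ≤ ∑ k, condMultiInfo (σ k) := by
  classical
  -- `V k` is the inclusion of the `k`-th summand of the direct sum of the extending systems
  let V : ∀ k, Matrix ((k : K) × F k) (F k) ℂ := fun k =>
    Matrix.of fun p e => if p = ⟨k, e⟩ then 1 else 0
  have hVV : ∀ k, (V k)ᴴ * V k = 1 := by
    intro k
    ext e f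
    simp [V, Matrix.mul_apply, Matrix.one_apply, eq_comm]
  have hVne : ∀ k l, l ≠ k → (V k)ᴴ * V l = 0 := by
    intro k l hkl
    ext e f
    simp only [V, Matrix.mul_apply, Matrix.conjTranspose_apply, Matrix.of_apply, mul_ite, mul_one,
      mul_zero, Finset.sum_ite_eq', Finset.mem_univ, if_true, Matrix.zero_apply]
    rw [if_neg fun h => hkl (congrArg Sigma.fst h), star_zero]
  have hsum : ∑ k, ((V k)ᴴ)ᴴ * (V k)ᴴ = 1 := by
    ext ⟨k, e⟩ ⟨l, f⟩
    rw [Matrix.sum_apply]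
    simp only [V, Matrix.mul_apply, Matrix.conjTranspose_apply, Matrix.of_apply, apply_ite star,
      star_one, star_zero, ite_mul, one_mul, zero_mul]
    rw [← Fintype.sum_sigma' (f := fun k' e' => if (⟨k, e⟩ : (k : K) × F k) = ⟨k', e'⟩ then
      (if (⟨l, f⟩ : (k : K) × F k) = ⟨k', e'⟩ then (1 : ℂ) else 0) else 0)]
    simp [Matrix.one_apply, eq_comm]
  set T : K → Op (Sys d × ((k : K) × F k)) := fun k =>
    ((1 : Op (Sys d)) ⊗ₖ V k) * σ k * ((1 : Op (Sys d)) ⊗ₖ V k)ᴴ with hT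
  have hTpos : ∀ k, (T k).PosSemidef := fun k => (hσ k).mul_mul_conjTranspose_same _
  have hτ : (∑ k, T k).PosSemidef := Matrix.posSemidef_sum _ fun k _ => hTpos k
  have hmarg : ∀ j, marginal j (∑ k, T k) = ∑ k, marginal j (T k) := by
    intro j
    ext p q
    simp only [marginal, Matrix.of_apply, Matrix.sum_apply]
    rw [Finset.sum_comm]
    refine Finset.sum_congr rfl fun s _ => ?_
    split_ifs <;> simp
  refine ⟨(k : K) × F k, inferInstance, inferInstance, ∑ k, T k, hτ, ?_, ?_⟩
  · have : traceRight (∑ k, T k) = ∑ k, traceRight (T k) := by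
      ext a b
      simp only [traceRight, Matrix.of_apply, Matrix.sum_apply]
      exact Finset.sum_comm
    rw [this]
    exact Finset.sum_congr rfl fun k _ => traceRight_conj_one_kronecker (hVV k) (σ k)
  -- measuring the flag recovers the extension `σ k`
  have h1 : ∀ j, condEntropy (marginal j (∑ k, T k)) ≤ ∑ k, condEntropy (marginal j (σ k)) := by
    intro j
    refine (condEntropy_le_sum_condEntropy_conj (b' := F) (V := fun k => (V k)ᴴ)
      (posSemidef_marginal j hτ) hsum).trans_eq ?_
    refine Finset.sum_congr rfl fun k _ => congrArg condEntropy ?_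
    rw [hmarg, Matrix.mul_sum, Matrix.sum_mul, Finset.sum_eq_single k]
    · rw [hT, marginal_conj_one_kronecker]
      simp only [Matrix.conjTranspose_kronecker, Matrix.conjTranspose_one,
        Matrix.conjTranspose_conjTranspose]
      rw [← Matrix.mul_assoc, ← Matrix.mul_assoc, ← Matrix.mul_kronecker_mul, hVV,
        Matrix.mul_assoc, ← Matrix.mul_kronecker_mul, hVV, Matrix.one_mul,
        Matrix.one_kronecker_one, Matrix.one_mul, Matrix.mul_one]
    · intro l _ hl
      rw [hT, marginal_conj_one_kronecker, ← Matrix.mul_assoc, ← Matrix.mul_assoc,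
        ← Matrix.mul_kronecker_mul, hVne k l hl, Matrix.kronecker_zero]
      simp
    · simp
  have h2 : ∑ k, condEntropy (σ k) ≤ condEntropy (∑ k, T k) := by
    refine le_trans (Finset.sum_le_sum fun k _ => ?_) (sum_condEntropy_le_condEntropy_sum hTpos)
    have := condEntropy_le_sum_condEntropy_conj (L := Unit) (V := fun _ => V k) (hσ k)
      (by rw [Fintype.sum_unique, hVV])
    rwa [Fintype.sum_unique] at this
  simp only [condMultiInfo, Finset.sum_sub_distrib]
  rw [Finset.sum_comm]
  exact sub_le_sub (Finset.sum_le_sum fun j _ => h1 j) h2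

end

section

/-! ### Squashed entanglement of positive operators -/

variable {m : ℕ} {d d' : Fin m → ℕ}

/-- Values of `I(X₁;⋯;Xₘ|E)` on the positive extensions of an operator, which need not be
normalised. -/
def extensionInfos (M : Op (Sys d)) : Set ℝ :=
  {r : ℝ | ∃ (E : Type) (_ : Fintype E) (_ : DecidableEq E) (σ : Op (Sys d × E)),
    σ.PosSemidef ∧ traceRight σ = M ∧ r = condMultiInfo σ}

/-- Squashed entanglement of a positive operator, not necessarily normalised. On states it is
`Esq`; it is positively homogeneous, so that `p * Esq (M / p)` becomes `EsqPos M`. -/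
noncomputable def EsqPos (M : Op (Sys d)) : ℝ := (1 / 2) * sInf (extensionInfos M)

lemma Esq_eq_EsqPos {ρ : Op (Sys d)} (hρ : IsState ρ) : Esq ρ = EsqPos ρ := by
  rw [Esq, EsqPos]
  congr 2
  ext r
  constructor
  · rintro ⟨E, i1, i2, σ, hσ, h, hr⟩
    exact ⟨E, i1, i2, σ, hσ.1, h, hr⟩
  · rintro ⟨E, i1, i2, σ, hσ, h, hr⟩
    refine ⟨E, i1, i2, σ, ⟨hσ, ?_⟩, h, hr⟩
    rw [← trace_traceRight, h, hρ.2]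

lemma nonneg_of_mem_extensionInfos {M : Op (Sys d)} {r : ℝ} (hr : r ∈ extensionInfos M) :
    0 ≤ r := by
  obtain ⟨E, _, _, σ, hσ, -, rfl⟩ := hr
  exact condMultiInfo_nonneg hσ

/-- Every positive operator is extended by a trivial system. -/
lemma extensionInfos_nonempty {M : Op (Sys d)} (hM : M.PosSemidef) :
    (extensionInfos M).Nonempty := by
  refine ⟨_, Unit, inferInstance, inferInstance, M.submatrix Prod.fst Prod.fst, hM.submatrix _,
    ?_, rfl⟩
  ext a b
  simp [traceRight]

lemma EsqPos_nonneg (M : Op (Sys d)) : 0 ≤ EsqPos M :=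
  mul_nonneg (by norm_num) (Real.sInf_nonneg fun _ => nonneg_of_mem_extensionInfos)

lemma EsqPos_traceRight_le {E : Type} [Fintype E] [DecidableEq E] {σ : Op (Sys d × E)}
    (hσ : σ.PosSemidef) : EsqPos (traceRight σ) ≤ (1 / 2) * condMultiInfo σ := by
  refine mul_le_mul_of_nonneg_left (csInf_le ⟨0, fun _ => nonneg_of_mem_extensionInfos⟩ ?_)
    (by norm_num)
  exact ⟨E, _, _, σ, hσ, rfl, rfl⟩

lemma le_EsqPos {M : Op (Sys d)} (hM : M.PosSemidef) {c : ℝ}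
    (h : ∀ (E : Type) [Fintype E] [DecidableEq E] (σ : Op (Sys d × E)), σ.PosSemidef →
      traceRight σ = M → c ≤ (1 / 2) * condMultiInfo σ) : c ≤ EsqPos M := by
  have : 2 * c ≤ sInf (extensionInfos M) := by
    refine le_csInf (extensionInfos_nonempty hM) ?_
    rintro r ⟨E, _, _, σ, hσ, hσM, rfl⟩
    have := h E σ hσ hσM
    linarith
  rw [EsqPos]
  linarith

lemma exists_extension_lt {M : Op (Sys d)} (hM : M.PosSemidef) {ε : ℝ} (hε : 0 < ε) :
    ∃ (E : Type) (_ : Fintype E) (_ : DecidableEq E) (σ : Op (Sys d × E)),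
      σ.PosSemidef ∧ traceRight σ = M ∧ (1 / 2) * condMultiInfo σ < EsqPos M + ε := by
  by_contra! hcon
  have := le_EsqPos hM fun E _ _ σ hσ hσM => hcon E _ _ σ hσ hσM
  linarith

lemma EsqPos_zero : EsqPos (0 : Op (Sys d)) = 0 := by
  have h0 : (0 : Op (Sys d × Unit)).PosSemidef := Matrix.PosSemidef.zero
  have h1 := EsqPos_traceRight_le h0
  have h2 : traceRight (0 : Op (Sys d × Unit)) = 0 := by
    ext a b
    simp [traceRight]
  have h3 : condMultiInfo (0 : Op (Sys d × Unit)) = 0 := by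
    simpa using condMultiInfo_smul h0 0
  rw [h2, h3, mul_zero] at h1
  exact le_antisymm h1 (EsqPos_nonneg 0)

lemma EsqPos_smul_le {M : Op (Sys d)} (hM : M.PosSemidef) {c : ℝ} (hc : 0 < c) :
    EsqPos (c • M) ≤ c * EsqPos M := by
  have h : c⁻¹ * EsqPos (c • M) ≤ EsqPos M := by
    refine le_EsqPos hM fun E _ _ σ hσ hσM => ?_
    have h1 := EsqPos_traceRight_le (hσ.smul hc.le)
    have h2 : traceRight (c • σ) = c • M := by
      rw [← hσM]
      ext a b
      simp [traceRight, Finset.mul_sum]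
    rw [h2, condMultiInfo_smul hσ] at h1
    rw [inv_mul_le_iff₀ hc]
    linarith
  rwa [inv_mul_le_iff₀ hc] at h

lemma EsqPos_smul {M : Op (Sys d)} (hM : M.PosSemidef) {c : ℝ} (hc : 0 ≤ c) :
    EsqPos (c • M) = c * EsqPos M := by
  rcases hc.eq_or_lt with rfl | hc
  · simp [EsqPos_zero]
  refine le_antisymm (EsqPos_smul_le hM hc) ?_
  have := EsqPos_smul_le (hM.smul hc.le) (inv_pos.2 hc)
  rwa [smul_smul, inv_mul_cancel₀ hc.ne', one_smul, ← mul_le_mul_iff_right₀ hc, ← mul_assoc,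
    mul_inv_cancel₀ hc.ne', one_mul] at this

/-- Convexity, in homogeneous form. -/
theorem EsqPos_sum_le {K : Type} [Fintype K] {M : K → Op (Sys d)}
    (hM : ∀ k, (M k).PosSemidef) : EsqPos (∑ k, M k) ≤ ∑ k, EsqPos (M k) := by
  refine le_of_forall_pos_le_add fun ε hε => ?_
  have hc : (0 : ℝ) < Fintype.card K + 1 := by positivity
  choose F i1 i2 σ hσ hσM hlt using fun k => exists_extension_lt (hM k) (div_pos hε hc)
  obtain ⟨G, _, _, τ, hτ, hτM, hle⟩ := exists_flagged_extension hσ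
  simp only [hσM] at hτM
  have h1 := EsqPos_traceRight_le hτ
  rw [hτM] at h1
  have h2 : ∑ k, (1 / 2) * condMultiInfo (σ k) ≤
      ∑ k, (EsqPos (M k) + ε / (Fintype.card K + 1)) :=
    Finset.sum_le_sum fun k _ => (hlt k).le
  rw [← Finset.mul_sum, Finset.sum_add_distrib, Finset.sum_const, Finset.card_univ,
    nsmul_eq_mul] at h2
  have h3 : (Fintype.card K : ℝ) * (ε / (Fintype.card K + 1)) ≤ ε := by
    rw [mul_div_assoc', div_le_iff₀ hc]
    nlinarith
  linarith

lemma EsqPos_finsetSum_le {K : Type} [Fintype K] {M : K → Op (Sys d)}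
    (hM : ∀ k, (M k).PosSemidef) (s : Finset K) :
    EsqPos (∑ k ∈ s, M k) ≤ ∑ k ∈ s, EsqPos (M k) := by
  rw [← Finset.sum_coe_sort s, ← Finset.sum_coe_sort s]
  exact EsqPos_sum_le fun k : s => hM k

/-! ### Monotonicity under local operations and classical communication -/

/-- For an outcome of probability `0` both sides vanish, so the undefined post-measurement state
does not matter. -/
lemma outcomeProb_mul_Esq_postState {K : Type} {Λ : K → Op (Sys d) → Op (Sys d')}
    {ρ : Op (Sys d)} {k : K} (h : (Λ k ρ).PosSemidef) :
    outcomeProb Λ ρ k * Esq (postState Λ ρ k) = EsqPos (Λ k ρ) := by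
  have htr : (Λ k ρ).trace = (outcomeProb Λ ρ k : ℂ) :=
    Complex.ext rfl (Complex.le_def.1 h.trace_nonneg).2.symm
  have hp : 0 ≤ outcomeProb Λ ρ k := (Complex.le_def.1 h.trace_nonneg).1
  rcases hp.eq_or_lt with h0 | hp
  · rw [← h0, Complex.ofReal_zero, h.trace_eq_zero_iff] at htr
    rw [← h0, htr, EsqPos_zero, zero_mul]
  · have hstate : IsState (postState Λ ρ k) := by
      refine ⟨h.smul (inv_nonneg.2 hp.le), ?_⟩
      rw [postState, Matrix.trace_smul, htr, Complex.real_smul, ← Complex.ofReal_mul,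
        inv_mul_cancel₀ hp.ne', Complex.ofReal_one]
    rw [Esq_eq_EsqPos hstate, postState, EsqPos_smul h (inv_nonneg.2 hp.le), ← mul_assoc,
      mul_inv_cancel₀ hp.ne', one_mul]

theorem sum_EsqPos_le_of_isUnilocalInstrument {K : Type} [Fintype K] {i : Fin m}
    {Λ : K → Op (Sys d) → Op (Sys d')} (hΛ : IsUnilocalInstrument i Λ) {M : Op (Sys d)}
    (hM : M.PosSemidef) :
    (∀ k, (Λ k M).PosSemidef) ∧ ∑ k, EsqPos (Λ k M) ≤ EsqPos M := by
  obtain ⟨h, Φ, hΦ, hΛ⟩ := hΛ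
  have key : ∀ (E : Type) [Fintype E] [DecidableEq E] (σ : Op (Sys d × E)), σ.PosSemidef →
      traceRight σ = M → (∀ k, (Λ k M).PosSemidef) ∧
        ∑ k, EsqPos (Λ k M) ≤ (1 / 2) * condMultiInfo σ := by
    intro E _ _ σ hσ hσM
    obtain ⟨hpos, hle⟩ := sum_condMultiInfo_applyAtProd_le i h hΦ hσ
    have e : ∀ k, Λ k M = traceRight (applyAtProd i h (Φ k) σ) := fun k => by
      rw [hΛ, ← hσM, traceRight_applyAtProd]
    simp only [e]
    refine ⟨fun k => posSemidef_traceRight (hpos k), ?_⟩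
    refine (Finset.sum_le_sum fun k _ => EsqPos_traceRight_le (hpos k)).trans ?_
    rw [← Finset.mul_sum]
    linarith
  obtain ⟨_, E, _, _, σ, hσ, hσM, -⟩ := extensionInfos_nonempty hM
  exact ⟨(key E σ hσ hσM).1, le_EsqPos hM fun E _ _ σ hσ hσM => (key E σ hσ hσM).2⟩

theorem sum_EsqPos_le_of_isLOCC {K : Type} [Fintype K] {Λ : K → Op (Sys d) → Op (Sys d')}
    (hΛ : IsLOCC d d' K Λ) {M : Op (Sys d)} (hM : M.PosSemidef) :
    (∀ k, (Λ k M).PosSemidef) ∧ ∑ k, EsqPos (Λ k M) ≤ EsqPos M := by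
  induction hΛ with
  | refl => exact ⟨fun _ => hM, by simp⟩
  | step i Φ _ hΦ ih =>
    refine ⟨fun p => (sum_EsqPos_le_of_isUnilocalInstrument (hΦ p.1) (ih.1 p.1)).1 p.2, ?_⟩
    rw [Fintype.sum_sigma]
    exact (Finset.sum_le_sum fun k _ =>
      (sum_EsqPos_le_of_isUnilocalInstrument (hΦ k) (ih.1 k)).2).trans ih.2
  | forget f _ ih =>
    refine ⟨fun l => Matrix.posSemidef_sum _ fun k _ => ih.1 k, ?_⟩
    refine (Finset.sum_le_sum fun l _ => EsqPos_finsetSum_le ih.1 _).trans ?_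
    rw [Finset.sum_fiberwise]
    exact ih.2

lemma isState_convexCombination {ρ σ : Op (Sys d)} (hρ : IsState ρ) (hσ : IsState σ) {s t : ℝ}
    (hs : 0 ≤ s) (ht : 0 ≤ t) (hst : s + t = 1) : IsState (s • ρ + t • σ) := by
  refine ⟨(hρ.1.smul hs).add (hσ.1.smul ht), ?_⟩
  rw [Matrix.trace_add, Matrix.trace_smul, Matrix.trace_smul, hρ.2, hσ.2, ← add_smul, hst, one_smul]

theorem convexOn_Esq : ConvexOn ℝ {ρ : Op (Sys d) | IsState ρ} Esq := by
  refine ⟨fun ρ hρ σ hσ s t hs ht hst => isState_convexCombination hρ hσ hs ht hst,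
    fun ρ hρ σ hσ s t hs ht hst => ?_⟩
  have hp : ∀ b : Bool, (cond b (s • ρ) (t • σ)).PosSemidef :=
    fun b => by cases b; exacts [hσ.1.smul ht, hρ.1.smul hs]
  have h := EsqPos_sum_le hp
  simp only [Fintype.sum_bool, cond_true, cond_false] at h
  rw [Esq_eq_EsqPos (isState_convexCombination hρ hσ hs ht hst), Esq_eq_EsqPos hρ,
    Esq_eq_EsqPos hσ, smul_eq_mul, smul_eq_mul, ← EsqPos_smul hρ.1 hs, ← EsqPos_smul hσ.1 ht]
  exact h

end

end SquashedEntanglement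

theorem mainTheorem3 {m : ℕ} :
    -- no increase on average under LOCC
    (∀ (d d' : Fin m → ℕ) (K : Type) [Fintype K] (Λ : K → Op (Sys d) → Op (Sys d')),
      IsLOCC d d' K Λ → ∀ ρ : Op (Sys d), IsState ρ →
        ∑ k, outcomeProb Λ ρ k * Esq (postState Λ ρ k) ≤ Esq ρ) ∧
    -- no increase on average under unilocal quantum instruments
    (∀ (d d' : Fin m → ℕ) (K : Type) [Fintype K] (i : Fin m)
      (Λ : K → Op (Sys d) → Op (Sys d')),
      IsUnilocalInstrument i Λ → ∀ ρ : Op (Sys d), IsState ρ →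
        ∑ k, outcomeProb Λ ρ k * Esq (postState Λ ρ k) ≤ Esq ρ) ∧
    -- convexity on the set of density matrices
    (∀ d : Fin m → ℕ, ConvexOn ℝ {ρ : Op (Sys d) | IsState ρ} Esq) := by
  refine ⟨fun d d' K _ Λ hΛ ρ hρ => ?_, fun d d' K _ i Λ hΛ ρ hρ => ?_, fun d => convexOn_Esq⟩
  · obtain ⟨hpos, hle⟩ := sum_EsqPos_le_of_isLOCC hΛ hρ.1
    simpa only [outcomeProb_mul_Esq_postState (hpos _), Esq_eq_EsqPos hρ] using hle
  · obtain ⟨hpos, hle⟩ := sum_EsqPos_le_of_isUnilocalInstrument hΛ hρ.1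
    simpa only [outcomeProb_mul_Esq_postState (hpos _), Esq_eq_EsqPos hρ] using hle
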